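/- Let $\mathcal{L}_{\mathrm{A}}=\{+,\cdot,\mathrm{S},<,0\}$ be the language of arithmetic, let $T$ be a new unary predicate, and let $\mathrm{PA}(T)$ be Robinson's arithmetic together with the induction scheme for all formulae of $\mathcal{L}_{\mathrm{A}}\cup\{T\}$. Fix a standard arithmetization of the syntax of $\mathcal{L}_{\mathrm{A}}$ (with variables $v_0,v_1,\dots$ and logical symbols $=,\neg,\wedge,\forall$). The theory $\mathrm{CT}$ (compositional truth) is $\mathrm{PA}(T)+\theta$, where $\theta$ is the sentence of $\mathcal{L}_{\mathrm{A}}\cup\{T\}$ saying that every element of $T$ is (the code of) an $\mathcal{L}_{\mathrm{A}}$-sentence and that, for all closed terms $s,t$, all sentences $\varphi,\psi$, and all sentences of the form $\forall v\,\chi(v)$, $$T(s=t)\leftrightarrow \mathrm{val}(s)=\mathrm{val}(t),\qquad T(s<t)\leftrightarrow \mathrm{val}(s)<\mathrm{val}(t),$$ $$T(\neg\varphi)\leftrightarrow\neg T(\varphi),\qquad T(\varphi\wedge\psi)\leftrightarrow T(\varphi)\wedge T(\psi),\qquad T(\forall v\,\chi(v))\leftrightarrow\forall x\,T(\chi(\dot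 x)),$$ where $\dot x$ is the numeral for $x$. For a structure $\mathcal{M}$, "$\mathcal{M}$-definable" means first order definable in $\mathcal{M}$ with parameters. Write $\mathcal{M}\trianglerighteq\mathcal{N}$ if the universe of $\mathcal{N}$ is an $\mathcal{M}$-definable subset of the universe of $\mathcal{M}$, and the relations and (the graphs of) the operations of $\mathcal{N}$ are $\mathcal{M}$-definable. A first order theory $U$ is *solid* if for all models $\mathcal{M}$, $\mathcal{N}$, $\mathcal{M}^{*}$ of $U$: if $\mathcal{M}\trianglerighteq\mathcal{N}\trianglerighteq\mathcal{M}^{*}$ and there is an $\mathcal{M}$-definable isomorphism $i_0:\mathcal{M}\to\mathcal{M}^{*}$, then there is an $\mathcal{M}$-definable isomorphism $i:\mathcal{M}\to\mathcal{N}$. **Theorem.** The theory $\mathrm{CT}$ is solid. -/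

import Mathlib

open FirstOrder FirstOrder.Language

universe u v w

/-! ### Interpretations between structures, definable isomorphisms, solid theories -/

namespace Solidity

/-- `e : N → M` presents the `K`-structure `N` as a structure that is interpreted in the
`L`-structure `M`: up to the identification of `N` with its image, the universe of `N` is a subset
of `M`, and this universe, the graphs of the operations of `N` and the relations of `N` are all
first-order definable in `M`, with parameters. (Literal subsets are the case of an inclusion.) -/
structure IsInterpretation (L : FirstOrder.Language.{u, v}) (K : FirstOrder.Language.{u, v}) {M N : Type w}
    [L.Structure M] [K.Structure N] (e : N → M) : Prop where
  injective : Function.Injective e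
  universe_definable : (Set.univ : Set M).Definable₁ L (Set.range e)
  fun_definable : ∀ {n : ℕ} (f : K.Functions n),
    (Set.univ : Set M).Definable L
      {x : Fin (n + 1) → M | ∃ y : Fin n → N,
        x = Fin.snoc (e ∘ y) (e (Structure.funMap f y))}
  rel_definable : ∀ {n : ℕ} (R : K.Relations n),
    (Set.univ : Set M).Definable L
      {x : Fin n → M | ∃ y : Fin n → N, Structure.RelMap R y ∧ x = e ∘ y}

/-- If `N` is presented inside `M` by `e`, the map `i : M → N` is `M`-definable when its graph is
first-order definable in `M`, with parameters. -/
def IsDefinableMap (L : FirstOrder.Language.{u, v}) {M N : Type w} [L.Structure M] (e : N → M)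
    (i : M → N) : Prop :=
  (Set.univ : Set M).Definable₂ L {p : M × M | p.2 = e (i p.1)}

/-- Solidity of a first-order theory `U`: for all models `M`, `N`, `M'` of `U` such that `M`
interprets `N` and `N` interprets `M'`, if there is an `M`-definable isomorphism from `M` to `M'`,
then there is an `M`-definable isomorphism from `M` to `N`. -/
def IsSolid {L : FirstOrder.Language.{u, v}} (U : L.Theory) : Prop :=
  ∀ (M N M' : Type w) [L.Structure M] [L.Structure N] [L.Structure M'],
    M ⊨ U → N ⊨ U → M' ⊨ U →
    ∀ (e : N → M) (e' : M' → N), IsInterpretation L L e → IsInterpretation L L e' →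
      (∃ i₀ : M ≃[L] M', IsDefinableMap L (e ∘ e') i₀) →
      ∃ i : M ≃[L] N, IsDefinableMap L e i

end Solidity

/-! ### The language of arithmetic with a truth predicate -/

namespace Truth

/-- The function symbols `0`, `S`, `+`, `·`. -/
inductive Func : ℕ → Type
  | zero : Func 0
  | succ : Func 1
  | add : Func 2
  | mul : Func 2

/-- The relation symbols `<` and `T`. -/
inductive Rel : ℕ → Type
  | lt : Rel 2
  | tr : Rel 1

/-- The language `{+, ·, S, <, 0}` of arithmetic together with the unary predicate `T`. -/
abbrev LangT : FirstOrder.Language.{0, 0} := ⟨Func, Rel⟩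

section

variable {α : Type}

def zero : LangT.Term α := Term.func (L := LangT) Func.zero ![]
def succ (s : LangT.Term α) : LangT.Term α := Term.func (L := LangT) Func.succ ![s]
def add (s t : LangT.Term α) : LangT.Term α := Term.func (L := LangT) Func.add ![s, t]
def mul (s t : LangT.Term α) : LangT.Term α := Term.func (L := LangT) Func.mul ![s, t]
def eq (s t : LangT.Term α) : LangT.Formula α := Term.equal s t
def lt (s t : LangT.Term α) : LangT.Formula α := Relations.formula (L := LangT) Rel.lt ![s, t]
def le (s t : LangT.Term α) : LangT.Formula α := lt s t ⊔ eq s t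
def tr (s : LangT.Term α) : LangT.Formula α := Relations.formula (L := LangT) Rel.tr ![s]

/-- Universal quantification of the free variable with name `i`. -/
def all [DecidableEq α] (i : α) (φ : LangT.Formula α) : LangT.Formula α :=
  BoundedFormula.all (n := 0)
    (BoundedFormula.relabel (n := 1) (fun j => if j = i then Sum.inr 0 else Sum.inl j) φ)

/-- Existential quantification of the free variable with name `i`. -/
def ex [DecidableEq α] (i : α) (φ : LangT.Formula α) : LangT.Formula α :=
  (all i φ.not).not

/-- The result of substituting `t` for the free variable with name `i`. -/
def substVar [DecidableEq α] (i : α) (t : LangT.Term α) (φ : LangT.Formula α) : LangT.Formula α :=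
  BoundedFormula.subst φ (Function.update Term.var i t)

end

/-- Terms and formulas with variables named by natural numbers. -/
abbrev Tm := LangT.Term ℕ
abbrev Fm := LangT.Formula ℕ

def x (i : ℕ) : Tm := Term.var i

/-- The numeral `S ⋯ S 0`. -/
def num : ℕ → Tm
  | 0 => zero
  | k + 1 => succ (num k)

def alls (l : List ℕ) (φ : Fm) : Fm := l.foldr all φ
def exs (l : List ℕ) (φ : Fm) : Fm := l.foldr ex φ

/-- `app φ [t₀, …, tₖ]` is `φ(t₀, …, tₖ)`: the simultaneous (capture-avoiding) substitution of the
terms for the variables `x 0, …, x k`, which are meant to be all the free variables of `φ`. -/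
def app (φ : Fm) (l : List Tm) : Fm := BoundedFormula.subst φ (fun i => l.getD i zero)

/-- A formula without free variables, as a sentence. -/
def toSentence (φ : Fm) : LangT.Sentence := BoundedFormula.subst φ (fun _ => zero)

/-! ### Peano arithmetic with induction for all formulas of the extended language -/

/-- The axioms of Robinson's arithmetic. -/
def robinson : LangT.Theory :=
  { toSentence (alls [0] (eq (succ (x 0)) zero).not),
    toSentence (alls [0, 1] ((eq (succ (x 0)) (succ (x 1))).imp (eq (x 0) (x 1)))),
    toSentence (alls [0] ((eq (x 0) zero).not.imp (exs [1] (eq (x 0) (succ (x 1)))))),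
    toSentence (alls [0] (eq (add (x 0) zero) (x 0))),
    toSentence (alls [0, 1] (eq (add (x 0) (succ (x 1))) (succ (add (x 0) (x 1))))),
    toSentence (alls [0] (eq (mul (x 0) zero) zero)),
    toSentence (alls [0, 1] (eq (mul (x 0) (succ (x 1))) (add (mul (x 0) (x 1)) (x 0)))),
    toSentence (alls [0, 1]
      ((lt (x 0) (x 1)).iff (exs [2] (eq (add (x 0) (succ (x 2))) (x 1))))) }

/-- The universal closure of `φ(0) ∧ ∀ x (φ(x) → φ(S x)) → ∀ x φ(x)`, where `x` is the variable
with index `0` and the other variables are parameters. -/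
noncomputable def inductionAxiom {n : ℕ} (φ : LangT.Formula (Fin (n + 1))) : LangT.Sentence :=
  Formula.iAlls (Fin (n + 1)) (Formula.relabel Sum.inr
    ((substVar 0 zero φ ⊓ all 0 (φ.imp (substVar 0 (succ (Term.var 0)) φ))).imp (all 0 φ)))

/-- `PA(T)`. -/
noncomputable def PAT : LangT.Theory :=
  robinson ∪ {σ | ∃ (n : ℕ) (φ : LangT.Formula (Fin (n + 1))), σ = inductionAxiom φ}

/-! ### Pairs and coded finite sets -/

/-- `z = ⟨s, t⟩`, Cantor's pairing function `(s + t)(s + t + 1) / 2 + t`. -/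
def isPair (z s t : Tm) : Fm :=
  eq (add z z) (add (mul (add s t) (succ (add s t))) (add t t))

/-- `s` belongs to the finite set coded by `a, b, m`, that is,
to `{i ≤ m : 1 + (i + 1) b divides a}`. -/
def mem (s a b m : Tm) : Fm :=
  le s m ⊓ app (exs [3] (eq (x 1) (mul (x 3) (succ (mul (succ (x 0)) (x 2)))))) [s, a, b]

/-- The pair `⟨s, t⟩` belongs to the finite set coded by `a, b, m`. -/
def pairMem (s t a b m : Tm) : Fm :=
  app (exs [5] (isPair (x 5) (x 0) (x 1) ⊓ mem (x 5) (x 2) (x 3) (x 4))) [s, t, a, b, m]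

/-! ### Arithmetization of the syntax of the language `{+, ·, S, <, 0}`

An expression is coded by `⟨k, c⟩`, where the number `k` tells its outermost symbol and `c` codes
its immediate constituents. The set-like predicates below (terms, formulas, …) and the recursively
defined operations (value, numeral, substitution) say that there is a finite coded set that
contains the object, or the pair of argument and result, and each element of which arises by one of
the clauses of the recursion from elements of the set. In these definitions `x 20, x 21, x 22` is
the coded set, and the clauses are about its element `x 10`, or its element `⟨x 10, x 11⟩`. -/

def unary (k : ℕ) (z s : Tm) : Fm := isPair z (num k) s

def binary (k : ℕ) (z s t : Tm) : Fm :=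
  app (exs [3] (isPair (x 3) (x 1) (x 2) ⊓ unary k (x 0) (x 3))) [z, s, t]

/-- `z` is the variable `v_i`. -/
def isVar (z i : Tm) : Fm := unary 1 z i
/-- `z` is the constant symbol `0`. -/
def isZero (z : Tm) : Fm := unary 2 z zero
/-- `z` is the term `S s`. -/
def isSucc (z s : Tm) : Fm := unary 3 z s
/-- `z` is the term `s + t`. -/
def isAdd (z s t : Tm) : Fm := binary 4 z s t
/-- `z` is the term `s · t`. -/
def isMul (z s t : Tm) : Fm := binary 5 z s t
/-- `z` is the formula `s = t`. -/
def isEq (z s t : Tm) : Fm := binary 6 z s t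
/-- `z` is the formula `s < t`. -/
def isLt (z s t : Tm) : Fm := binary 7 z s t
/-- `z` is the formula `¬ s`. -/
def isNeg (z s : Tm) : Fm := unary 8 z s
/-- `z` is the formula `s ∧ t`. -/
def isConj (z s t : Tm) : Fm := binary 9 z s t
/-- `z` is the formula `∀ v_i s`. -/
def isAll (z i s : Tm) : Fm := binary 10 z i s

def inSet (s : Tm) : Fm := mem s (x 20) (x 21) (x 22)
def pairInSet (s t : Tm) : Fm := pairMem s t (x 20) (x 21) (x 22)

def certified (s : Tm) (clauses : Fm) : Fm :=
  exs [20, 21, 22] (inSet s ⊓ all 10 ((inSet (x 10)).imp clauses))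

def pairCertified (s t : Tm) (clauses : Fm) : Fm :=
  exs [20, 21, 22] (pairInSet s t ⊓ alls [10, 11] ((pairInSet (x 10) (x 11)).imp clauses))

/-- `s` is a term. -/
def isTerm (s : Tm) : Fm :=
  app (certified (x 0)
    (exs [4] (isVar (x 10) (x 4))
      ⊔ isZero (x 10)
      ⊔ exs [4] (isSucc (x 10) (x 4) ⊓ inSet (x 4))
      ⊔ exs [4, 5] ((isAdd (x 10) (x 4) (x 5) ⊔ isMul (x 10) (x 4) (x 5))
          ⊓ inSet (x 4) ⊓ inSet (x 5)))) [s]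

/-- The variable `v_i` occurs in the term `s`. -/
def occursIn (i s : Tm) : Fm :=
  app (certified (x 1)
    (isVar (x 10) (x 0)
      ⊔ exs [4] (isSucc (x 10) (x 4) ⊓ inSet (x 4))
      ⊔ exs [4, 5] ((isAdd (x 10) (x 4) (x 5) ⊔ isMul (x 10) (x 4) (x 5))
          ⊓ (inSet (x 4) ⊔ inSet (x 5))))) [i, s]

/-- `s` is a closed term. -/
def isClosedTerm (s : Tm) : Fm :=
  app (isTerm (x 0) ⊓ all 1 (occursIn (x 1) (x 0)).not) [s]

/-- `s` is a formula. -/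
def isFormula (s : Tm) : Fm :=
  app (certified (x 0)
    (exs [4, 5] ((isEq (x 10) (x 4) (x 5) ⊔ isLt (x 10) (x 4) (x 5))
          ⊓ isTerm (x 4) ⊓ isTerm (x 5))
      ⊔ exs [4] (isNeg (x 10) (x 4) ⊓ inSet (x 4))
      ⊔ exs [4, 5] (isConj (x 10) (x 4) (x 5) ⊓ inSet (x 4) ⊓ inSet (x 5))
      ⊔ exs [4, 5] (isAll (x 10) (x 4) (x 5) ⊓ inSet (x 5)))) [s]

/-- The variable `v_i` occurs free in the formula `s`. -/
def freeIn (i s : Tm) : Fm :=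
  app (certified (x 1)
    (exs [4, 5] ((isEq (x 10) (x 4) (x 5) ⊔ isLt (x 10) (x 4) (x 5))
          ⊓ (occursIn (x 0) (x 4) ⊔ occursIn (x 0) (x 5)))
      ⊔ exs [4] (isNeg (x 10) (x 4) ⊓ inSet (x 4))
      ⊔ exs [4, 5] (isConj (x 10) (x 4) (x 5) ⊓ (inSet (x 4) ⊔ inSet (x 5)))
      ⊔ exs [4, 5] (isAll (x 10) (x 4) (x 5) ⊓ (eq (x 4) (x 0)).not ⊓ inSet (x 5)))) [i, s]

/-- `s` is a sentence. -/
def isSentence (s : Tm) : Fm :=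
  app (isFormula (x 0) ⊓ all 1 (freeIn (x 1) (x 0)).not) [s]

/-- `y` is the value of the closed term `s`. -/
def hasValue (s y : Tm) : Fm :=
  app (pairCertified (x 0) (x 1)
    ((isZero (x 10) ⊓ eq (x 11) zero)
      ⊔ exs [4, 5] (isSucc (x 10) (x 4) ⊓ eq (x 11) (succ (x 5)) ⊓ pairInSet (x 4) (x 5))
      ⊔ exs [4, 5, 6, 7]
          (((isAdd (x 10) (x 4) (x 6) ⊓ eq (x 11) (add (x 5) (x 7)))
              ⊔ (isMul (x 10) (x 4) (x 6) ⊓ eq (x 11) (mul (x 5) (x 7))))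
            ⊓ pairInSet (x 4) (x 5) ⊓ pairInSet (x 6) (x 7)))) [s, y]

/-- `t` is the numeral for the number `n`. -/
def isNumeral (n t : Tm) : Fm :=
  app (pairCertified (x 0) (x 1)
    ((eq (x 10) zero ⊓ isZero (x 11))
      ⊔ exs [4, 5] (eq (x 10) (succ (x 4)) ⊓ isSucc (x 11) (x 5)
          ⊓ pairInSet (x 4) (x 5)))) [n, t]

/-- The term `s'` is the result of substituting the term `t` for the variable `v_i` in the
term `s`. -/
def isTermSubst (i t s s' : Tm) : Fm :=
  app (pairCertified (x 2) (x 3)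
    ((isVar (x 10) (x 0) ⊓ eq (x 11) (x 1))
      ⊔ exs [4] (isVar (x 10) (x 4) ⊓ (eq (x 4) (x 0)).not ⊓ eq (x 11) (x 10))
      ⊔ (isZero (x 10) ⊓ isZero (x 11))
      ⊔ exs [4, 5] (isSucc (x 10) (x 4) ⊓ isSucc (x 11) (x 5) ⊓ pairInSet (x 4) (x 5))
      ⊔ exs [4, 5, 6, 7]
          (((isAdd (x 10) (x 4) (x 6) ⊓ isAdd (x 11) (x 5) (x 7))
              ⊔ (isMul (x 10) (x 4) (x 6) ⊓ isMul (x 11) (x 5) (x 7)))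
            ⊓ pairInSet (x 4) (x 5) ⊓ pairInSet (x 6) (x 7)))) [i, t, s, s']

/-- The formula `s'` is the result of substituting the closed term `t` for the free occurrences of
the variable `v_i` in the formula `s`. -/
def isSubst (i t s s' : Tm) : Fm :=
  app (pairCertified (x 2) (x 3)
    (exs [4, 5, 6, 7]
        (((isEq (x 10) (x 4) (x 6) ⊓ isEq (x 11) (x 5) (x 7))
            ⊔ (isLt (x 10) (x 4) (x 6) ⊓ isLt (x 11) (x 5) (x 7)))
          ⊓ isTermSubst (x 0) (x 1) (x 4) (x 5) ⊓ isTermSubst (x 0) (x 1) (x 6) (x 7))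
      ⊔ exs [4, 5] (isNeg (x 10) (x 4) ⊓ isNeg (x 11) (x 5) ⊓ pairInSet (x 4) (x 5))
      ⊔ exs [4, 5, 6, 7]
          (isConj (x 10) (x 4) (x 6) ⊓ isConj (x 11) (x 5) (x 7)
            ⊓ pairInSet (x 4) (x 5) ⊓ pairInSet (x 6) (x 7))
      ⊔ exs [4] (isAll (x 10) (x 0) (x 4) ⊓ eq (x 11) (x 10))
      ⊔ exs [4, 5, 6]
          (isAll (x 10) (x 6) (x 4) ⊓ isAll (x 11) (x 6) (x 5) ⊓ (eq (x 6) (x 0)).not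
            ⊓ pairInSet (x 4) (x 5)))) [i, t, s, s']

/-! ### Compositional truth -/

/-- Everything in `T` is an arithmetical sentence. -/
def onlySentences : Fm :=
  all 0 ((tr (x 0)).imp (isSentence (x 0)))

/-- `T(s = t)` iff the closed terms `s` and `t` have the same value. -/
def truthEq : Fm :=
  alls [0, 1, 2]
    ((isClosedTerm (x 0) ⊓ isClosedTerm (x 1) ⊓ isEq (x 2) (x 0) (x 1)).imp
      ((tr (x 2)).iff (exs [3] (hasValue (x 0) (x 3) ⊓ hasValue (x 1) (x 3)))))

/-- `T(s < t)` iff the value of the closed term `s` is less than that of the closed term `t`. -/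
def truthLt : Fm :=
  alls [0, 1, 2]
    ((isClosedTerm (x 0) ⊓ isClosedTerm (x 1) ⊓ isLt (x 2) (x 0) (x 1)).imp
      ((tr (x 2)).iff
        (exs [3, 4] (hasValue (x 0) (x 3) ⊓ hasValue (x 1) (x 4) ⊓ lt (x 3) (x 4)))))

/-- `T(¬ φ)` iff not `T(φ)`, for sentences `φ`. -/
def truthNeg : Fm :=
  alls [0, 1]
    ((isSentence (x 0) ⊓ isNeg (x 1) (x 0)).imp ((tr (x 1)).iff (tr (x 0)).not))

/-- `T(φ ∧ ψ)` iff `T(φ)` and `T(ψ)`, for sentences `φ` and `ψ`. -/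
def truthConj : Fm :=
  alls [0, 1, 2]
    ((isSentence (x 0) ⊓ isSentence (x 1) ⊓ isConj (x 2) (x 0) (x 1)).imp
      ((tr (x 2)).iff (tr (x 0) ⊓ tr (x 1))))

/-- `T(∀ v φ(v))` iff `T(φ(n))` for the numeral of every number `n`,
for sentences `∀ v φ(v)`. -/
def truthAll : Fm :=
  alls [0, 1, 2]
    ((isSentence (x 2) ⊓ isAll (x 2) (x 0) (x 1)).imp
      ((tr (x 2)).iff
        (alls [3, 4, 5]
          ((isNumeral (x 3) (x 4) ⊓ isSubst (x 0) (x 4) (x 1) (x 5)).imp (tr (x 5))))))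

/-- The sentence saying that `T` satisfies Tarski's clauses for arithmetical sentences. -/
def tarski : LangT.Sentence :=
  toSentence (onlySentences ⊓ truthEq ⊓ truthLt ⊓ truthNeg ⊓ truthConj ⊓ truthAll)

/-- The theory `CT` of compositional truth. -/
noncomputable def CT : LangT.Theory := PAT ∪ {tarski}

end Truth

/-! Let `M` interpret `N`, let `N` interpret `M'`, and let `i₀ : M ≅ M'` be definable in `M`.
Everything rests on `M` having induction for all formulas of its full language, hence for every
predicate definable in `M` with parameters (`induction_of_dfn`), including predicates about `N`,
once these are translated into `M` (`exists_translation`).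

Arithmetical part. Iterating the successor of `N` from its zero gives an `M`-definable map `j : M →
N` (`exists_canonical_map`). The recursion is run inside `M` through coded finite pieces of its
graph, whose existence is comprehension for bounded definable sets (`exists_code`, a version of
Gödel's β-function). Induction shows that `j` preserves `+` and `·`, hence `<`, so it is injective.
In the same way `N` has a map `k : N → M'`. By induction in `M`, `k ∘ j = i₀`, since both sides
preserve `0` and `S`. As `i₀` is surjective and `k` injective, `j` is onto (`canonical_bijective`).

Truth part. Pull the truth predicate of `N` back along `j`. As `j` is an isomorphism of the
arithmetical reducts, the result satisfies Tarski's clauses for the syntax of `M`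
(`isTruth_pullback`), and it is `M`-definable. Two `M`-definable predicates obeying Tarski's clauses
agree, by induction in `M` on the complexity of formulas, nonstandard ones included
(`IsTruth.unique`). So `j` respects `T` as well and is the required isomorphism. -/

namespace Truth

/-! ### Definability with parameters -/

section Definability

variable {M : Type w} [LangT.Structure M] {ι κ : Type}

/-- The predicate `P` of assignments is definable with parameters. -/
def Dfn (P : (ι → M) → Prop) : Prop :=
  ∃ φ : LangT.Formula (M ⊕ ι), ∀ v, φ.Realize (Sum.elim id v) ↔ P v

/-- The function `f` of assignments is given by a term with parameters. -/
def Tdf (f : (ι → M) → M) : Prop :=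
  ∃ t : LangT.Term (M ⊕ ι), ∀ v, t.realize (Sum.elim id v) = f v

/-- Definability of a unary predicate. -/
def Dfn₁ (P : M → Prop) : Prop := Dfn (fun v : Fin 1 → M => P (v 0))

/-- Definability of a binary predicate. -/
def Dfn₂ (P : M → M → Prop) : Prop := Dfn (fun v : Fin 2 → M => P (v 0) (v 1))

/-- Definability of a ternary predicate. -/
def Dfn₃ (P : M → M → M → Prop) : Prop := Dfn (fun v : Fin 3 → M => P (v 0) (v 1) (v 2))

theorem dfn_iff_definable {P : (ι → M) → Prop} :
    Dfn P ↔ (Set.univ : Set M).Definable LangT {v | P v} := by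
  rw [Set.definable_iff_exists_formula_sum]
  constructor
  · rintro ⟨φ, h⟩
    refine ⟨φ.relabel (Sum.map (fun a => ⟨a, trivial⟩) id), ?_⟩
    ext v
    rw [Set.mem_ofPred_eq, Set.mem_ofPred_eq, Formula.realize_relabel, ← h]
    apply iff_of_eq
    congr 1
    ext (a | a) <;> rfl
  · rintro ⟨φ, h⟩
    refine ⟨φ.relabel (Sum.map Subtype.val id), fun v => ?_⟩
    have := Set.ext_iff.1 h v
    rw [Set.mem_ofPred_eq, Set.mem_ofPred_eq] at this
    rw [this, Formula.realize_relabel]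
    apply iff_of_eq
    congr 1
    ext (a | a) <;> rfl

theorem Dfn.congr {P Q : (ι → M) → Prop} (h : Dfn P) (hPQ : ∀ v, P v ↔ Q v) : Dfn Q := by
  obtain ⟨φ, h⟩ := h
  exact ⟨φ, fun v => (h v).trans (hPQ v)⟩

theorem Dfn.false : Dfn (fun _ : ι → M => False) := ⟨⊥, fun _ => by simp⟩

theorem Dfn.and {P Q : (ι → M) → Prop} (hP : Dfn P) (hQ : Dfn Q) : Dfn (fun v => P v ∧ Q v) := by
  obtain ⟨φ, h⟩ := hP
  obtain ⟨ψ, h'⟩ := hQ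
  exact ⟨φ ⊓ ψ, fun v => by rw [Formula.realize_inf, h, h']⟩

theorem Dfn.or {P Q : (ι → M) → Prop} (hP : Dfn P) (hQ : Dfn Q) : Dfn (fun v => P v ∨ Q v) := by
  obtain ⟨φ, h⟩ := hP
  obtain ⟨ψ, h'⟩ := hQ
  exact ⟨φ ⊔ ψ, fun v => by rw [Formula.realize_sup, h, h']⟩

theorem Dfn.not {P : (ι → M) → Prop} (hP : Dfn P) : Dfn (fun v => ¬ P v) := by
  obtain ⟨φ, h⟩ := hP
  exact ⟨φ.not, fun v => by rw [Formula.realize_not, h]⟩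

theorem Dfn.imp {P Q : (ι → M) → Prop} (hP : Dfn P) (hQ : Dfn Q) : Dfn (fun v => P v → Q v) := by
  obtain ⟨φ, h⟩ := hP
  obtain ⟨ψ, h'⟩ := hQ
  exact ⟨φ.imp ψ, fun v => by rw [Formula.realize_imp, h, h']⟩

theorem Dfn.iff {P Q : (ι → M) → Prop} (hP : Dfn P) (hQ : Dfn Q) : Dfn (fun v => P v ↔ Q v) := by
  obtain ⟨φ, h⟩ := hP
  obtain ⟨ψ, h'⟩ := hQ
  exact ⟨φ.iff ψ, fun v => by rw [Formula.realize_iff, h, h']⟩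

theorem Dfn.all {P : (ι → M) → M → Prop}
    (hP : Dfn (fun w : Option ι → M => P (fun i => w (some i)) (w none))) :
    Dfn (fun v => ∀ a, P v a) := by
  obtain ⟨φ, h⟩ := hP
  -- The index `none` stands for the quantified variable and is turned into the bound one.
  let g : M ⊕ Option ι → (M ⊕ ι) ⊕ Fin 1 :=
    Sum.elim (fun a => Sum.inl (Sum.inl a))
      (fun o => o.elim (Sum.inr 0) (fun i => Sum.inl (Sum.inr i)))
  refine ⟨(BoundedFormula.relabel (n := 1) g φ).all, fun v => ?_⟩
  rw [Formula.Realize, BoundedFormula.realize_all]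
  refine forall_congr' fun a => ?_
  rw [BoundedFormula.realize_relabel]
  have := h (fun o => o.elim a v)
  refine Iff.trans ?_ this
  rw [Formula.Realize]
  apply iff_of_eq
  congr 1
  · ext (b | _ | b) <;> rfl
  · exact Subsingleton.elim _ _

theorem Dfn.ex {P : (ι → M) → M → Prop}
    (hP : Dfn (fun w : Option ι → M => P (fun i => w (some i)) (w none))) :
    Dfn (fun v => ∃ a, P v a) :=
  (Dfn.all (P := fun v a => ¬ P v a) hP.not).not.congr fun v => by push Not; rfl

theorem Dfn.comp {P : (κ → M) → Prop} (hP : Dfn P) {f : κ → (ι → M) → M} (hf : ∀ k, Tdf (f k)) :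
    Dfn (fun v => P (fun k => f k v)) := by
  obtain ⟨φ, h⟩ := hP
  choose t ht using hf
  refine ⟨BoundedFormula.subst φ (Sum.elim (fun a => Term.var (Sum.inl a)) t), fun v => ?_⟩
  refine Iff.trans ?_ (h _)
  rw [Formula.Realize, BoundedFormula.realize_subst, Formula.Realize]
  apply iff_of_eq
  congr 1
  ext (a | a)
  · rfl
  · exact ht a v

theorem Tdf.var (i : ι) : Tdf (fun v : ι → M => v i) := ⟨Term.var (Sum.inr i), fun _ => rfl⟩

theorem Tdf.const (a : M) : Tdf (fun _ : ι → M => a) := ⟨Term.var (Sum.inl a), fun _ => rfl⟩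

theorem Tdf.weaken {f : (ι → M) → M} (hf : Tdf f) :
    Tdf (fun w : Option ι → M => f (fun i => w (some i))) := by
  obtain ⟨t, h⟩ := hf
  refine ⟨t.relabel (Sum.map id some), fun w => ?_⟩
  refine Eq.trans ?_ (h _)
  rw [Term.realize_relabel]
  congr 1
  ext (a | a) <;> rfl

theorem Tdf.func {n : ℕ} (F : LangT.Functions n) {f : Fin n → (ι → M) → M} (hf : ∀ i, Tdf (f i)) :
    Tdf (fun v => Structure.funMap F (fun i => f i v)) := by
  choose t ht using hf
  exact ⟨Term.func F t, fun v => by simp [ht]⟩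

theorem Dfn.eq {f g : (ι → M) → M} (hf : Tdf f) (hg : Tdf g) : Dfn (fun v => f v = g v) := by
  obtain ⟨s, hs⟩ := hf
  obtain ⟨t, ht⟩ := hg
  exact ⟨Term.equal s t, fun v => by rw [Formula.realize_equal, hs, ht]⟩

theorem Dfn.rel {n : ℕ} (R : LangT.Relations n) {f : Fin n → (ι → M) → M} (hf : ∀ i, Tdf (f i)) :
    Dfn (fun v => Structure.RelMap R (fun i => f i v)) := by
  choose t ht using hf
  exact ⟨Relations.formula R t, fun v => by rw [Formula.realize_rel]; simp [ht]⟩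

theorem Dfn₁.app {P : M → Prop} (hP : Dfn₁ P) {f : (ι → M) → M} (hf : Tdf f) :
    Dfn (fun v => P (f v)) :=
  Dfn.comp hP (f := fun _ => f) fun _ => hf

theorem Dfn₂.app {P : M → M → Prop} (hP : Dfn₂ P) {f g : (ι → M) → M} (hf : Tdf f) (hg : Tdf g) :
    Dfn (fun v => P (f v) (g v)) :=
  Dfn.comp hP (f := ![f, g]) (by simp [Fin.forall_fin_two, hf, hg])

theorem Dfn₃.app {P : M → M → M → Prop} (hP : Dfn₃ P) {f g h : (ι → M) → M}
    (hf : Tdf f) (hg : Tdf g) (hh : Tdf h) :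
    Dfn (fun v => P (f v) (g v) (h v)) :=
  Dfn.comp hP (f := ![f, g, h]) (by simp [Fin.forall_fin_succ, hf, hg, hh])

end Definability

/-! ### Translation along an interpretation -/

section Translation

variable {M N : Type w} [LangT.Structure M] [LangT.Structure N] {e : N → M}

theorem dfn_range (he : Solidity.IsInterpretation LangT LangT e) :
    Dfn₁ (fun a => ∃ n, e n = a) :=
  dfn_iff_definable.2 he.universe_definable

theorem dfn_fun₀ (he : Solidity.IsInterpretation LangT LangT e) (F : LangT.Functions 0) :
    Dfn₁ (fun c => c = e (Structure.funMap F ![])) :=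
  (dfn_iff_definable.2 (he.fun_definable F)).congr fun v => by
    constructor
    · rintro ⟨y, hy⟩
      rw [hy, Subsingleton.elim ![] y]
      rfl
    · intro h
      refine ⟨![], ?_⟩
      ext i
      fin_cases i
      exact h

theorem dfn_fun₁ (he : Solidity.IsInterpretation LangT LangT e) (F : LangT.Functions 1) :
    Dfn₂ (fun a c => ∃ x, a = e x ∧ c = e (Structure.funMap F ![x])) :=
  (dfn_iff_definable.2 (he.fun_definable F)).congr fun v => by
    constructor
    · rintro ⟨y, rfl⟩
      refine ⟨y 0, rfl, ?_⟩
      rw [show ![y 0] = y by ext i; rw [Subsingleton.elim i 0]; rfl]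
      rfl
    · rintro ⟨x, h, h'⟩
      refine ⟨![x], ?_⟩
      ext i
      fin_cases i
      · exact h
      · exact h'

theorem dfn_fun₂ (he : Solidity.IsInterpretation LangT LangT e) (F : LangT.Functions 2) :
    Dfn₃ (fun a b c => ∃ x y, a = e x ∧ b = e y ∧ c = e (Structure.funMap F ![x, y])) :=
  (dfn_iff_definable.2 (he.fun_definable F)).congr fun v => by
    constructor
    · rintro ⟨y, rfl⟩
      refine ⟨y 0, y 1, rfl, rfl, ?_⟩
      rw [show ![y 0, y 1] = y by ext i; fin_cases i <;> rfl]
      rfl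
    · rintro ⟨x, y, h, h', h''⟩
      refine ⟨![x, y], ?_⟩
      ext i
      fin_cases i
      · exact h
      · exact h'
      · exact h''

theorem dfn_rel₁ (he : Solidity.IsInterpretation LangT LangT e) (R : LangT.Relations 1) :
    Dfn₁ (fun a => ∃ x, a = e x ∧ Structure.RelMap R ![x]) :=
  (dfn_iff_definable.2 (he.rel_definable R)).congr fun v => by
    constructor
    · rintro ⟨y, h, rfl⟩
      refine ⟨y 0, rfl, ?_⟩
      rwa [show ![y 0] = y by ext i; rw [Subsingleton.elim i 0]; rfl]
    · rintro ⟨x, h, h'⟩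
      refine ⟨![x], h', ?_⟩
      ext i
      rw [Subsingleton.elim i 0]
      exact h

theorem dfn_rel₂ (he : Solidity.IsInterpretation LangT LangT e) (R : LangT.Relations 2) :
    Dfn₂ (fun a b => ∃ x y, a = e x ∧ b = e y ∧ Structure.RelMap R ![x, y]) :=
  (dfn_iff_definable.2 (he.rel_definable R)).congr fun v => by
    constructor
    · rintro ⟨y, h, rfl⟩
      refine ⟨y 0, y 1, rfl, rfl, ?_⟩
      rwa [show ![y 0, y 1] = y by ext i; fin_cases i <;> rfl]
    · rintro ⟨x, y, h, h', h''⟩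
      refine ⟨![x, y], h'', ?_⟩
      ext i
      fin_cases i
      · exact h
      · exact h'

/-- Operations of `N` are available in `M` only through their graphs, so a term translates to a
definable relation rather than a term: nested terms are unravelled by quantifying over intermediate
values. The hypothesis on `u` says that each variable is either a fixed parameter from `N` or a
coordinate of the assignment. -/
theorem exists_graph_translation (he : Solidity.IsInterpretation LangT LangT e) {κ : Type}
    {α : Type w} (u : (κ → N) → α → N)
    (hu : ∀ a, (∃ n, ∀ y, u y a = n) ∨ ∃ k, ∀ y, u y a = y k) (t : LangT.Term α) :
    ∃ G : (κ → M) → M → Prop, Dfn (fun w : Option κ → M => G (fun k => w (some k)) (w none)) ∧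
      ∀ y c, G (fun k => e (y k)) c ↔ c = e (t.realize (u y)) := by
  induction t with
  | var a =>
    rcases hu a with ⟨n, hn⟩ | ⟨k, hk⟩
    · exact ⟨fun _ c => c = e n, Dfn.eq (.var _) (.const _), fun y c => by simp [hn]⟩
    · exact ⟨fun v c => c = v k, Dfn.eq (.var _) (.var _), fun y c => by simp [hk]⟩
  | func F ts ih =>
    choose G hG hG' using ih
    have key : ∀ i, Dfn (fun w : Option (Option κ) → M =>
        G i (fun k => w (some (some k))) (w none)) := fun i =>
      Dfn.comp (hG i) (f := fun o w => w (o.elim none (fun k => some (some k))))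
        (fun o => .var _)
    cases F with
    | zero =>
      refine ⟨fun _ c => c = e (Structure.funMap (L := LangT) Func.zero ![]),
        (dfn_fun₀ he Func.zero).app (.var _), fun y c => ?_⟩
      rw [Term.realize_func, Subsingleton.elim ![] (fun i => (ts i).realize (u y))]
    | succ =>
      refine ⟨fun v c => ∃ a, G 0 v a ∧ ∃ x, a = e x ∧
          c = e (Structure.funMap (L := LangT) Func.succ ![x]),
        Dfn.ex (Dfn.and (key 0) ((dfn_fun₁ he Func.succ).app (.var _) (.var _))), fun y c => ?_⟩
      have : (fun i => (ts i).realize (u y)) = ![(ts 0).realize (u y)] := by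
        ext i; fin_cases i; rfl
      rw [Term.realize_func, this]
      simp [hG', he.injective.eq_iff]
    | add =>
      refine ⟨fun v c => ∃ a, G 0 v a ∧ ∃ b, G 1 v b ∧ ∃ x y, a = e x ∧ b = e y ∧
          c = e (Structure.funMap (L := LangT) Func.add ![x, y]),
        Dfn.ex (Dfn.and (key 0) (Dfn.ex (Dfn.and
          (Dfn.comp (key 1) (f := fun o w => w (o.elim none (fun o => some (some o))))
            (fun o => .var _))
          ((dfn_fun₂ he Func.add).app (.var _) (.var _) (.var _))))), fun y c => ?_⟩
      have : (fun i => (ts i).realize (u y)) = ![(ts 0).realize (u y), (ts 1).realize (u y)] := by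
        ext i; fin_cases i <;> rfl
      rw [Term.realize_func, this]
      simp [hG', he.injective.eq_iff]
    | mul =>
      refine ⟨fun v c => ∃ a, G 0 v a ∧ ∃ b, G 1 v b ∧ ∃ x y, a = e x ∧ b = e y ∧
          c = e (Structure.funMap (L := LangT) Func.mul ![x, y]),
        Dfn.ex (Dfn.and (key 0) (Dfn.ex (Dfn.and
          (Dfn.comp (key 1) (f := fun o w => w (o.elim none (fun o => some (some o))))
            (fun o => .var _))
          ((dfn_fun₂ he Func.mul).app (.var _) (.var _) (.var _))))), fun y c => ?_⟩
      have : (fun i => (ts i).realize (u y)) = ![(ts 0).realize (u y), (ts 1).realize (u y)] := by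
        ext i; fin_cases i <;> rfl
      rw [Term.realize_func, this]
      simp [hG', he.injective.eq_iff]

/-- Quantifiers are relativized to the range of `e`. Free and bound variables together form the
assignment, so that the induction passes under quantifiers. -/
theorem exists_boundedFormula_translation (he : Solidity.IsInterpretation LangT LangT e) {ι : Type}
    {n : ℕ} (φ : LangT.BoundedFormula (N ⊕ ι) n) :
    ∃ Q : (ι ⊕ Fin n → M) → Prop, Dfn Q ∧
      ∀ y : ι ⊕ Fin n → N, Q (fun k => e (y k)) ↔
        φ.Realize (Sum.elim id (fun i => y (Sum.inl i))) (fun k => y (Sum.inr k)) := by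
  have graph {n : ℕ} (t : LangT.Term ((N ⊕ ι) ⊕ Fin n)) :=
    exists_graph_translation he (κ := ι ⊕ Fin n)
      (fun y => Sum.elim (Sum.elim id (fun i => y (Sum.inl i))) (fun k => y (Sum.inr k)))
      (by
        rintro ((a | i) | k)
        · exact Or.inl ⟨a, fun _ => rfl⟩
        · exact Or.inr ⟨Sum.inl i, fun _ => rfl⟩
        · exact Or.inr ⟨Sum.inr k, fun _ => rfl⟩) t
  induction φ with
  | falsum => exact ⟨fun _ => False, .false, fun y => by simp [BoundedFormula.Realize]⟩
  | equal s t =>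
    obtain ⟨G, hG, hG'⟩ := graph s
    obtain ⟨H, hH, hH'⟩ := graph t
    refine ⟨fun v => ∃ a, G v a ∧ H v a, Dfn.ex (hG.and hH), fun y => ?_⟩
    simp [hG', hH', he.injective.eq_iff, BoundedFormula.Realize]
  | rel R ts =>
    choose G hG hG' using fun i => graph (ts i)
    cases R with
    | tr =>
      refine ⟨fun v => ∃ a, G 0 v a ∧ ∃ x, a = e x ∧ Structure.RelMap (L := LangT) Rel.tr ![x],
        Dfn.ex ((hG 0).and ((dfn_rel₁ he Rel.tr).app (.var _))), fun y => ?_⟩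
      simp only [hG', he.injective.eq_iff, BoundedFormula.Realize, exists_eq_left]
      simp only [exists_eq_left']
      apply iff_of_eq
      congr 1
      ext i; fin_cases i; rfl
    | lt =>
      refine ⟨fun v => ∃ a, G 0 v a ∧ ∃ b, G 1 v b ∧
          ∃ x y, a = e x ∧ b = e y ∧ Structure.RelMap (L := LangT) Rel.lt ![x, y],
        Dfn.ex ((hG 0).and (Dfn.ex (Dfn.and
          (Dfn.comp (hG 1) (f := fun o w => w (o.elim none (fun o => some (some o))))
            (fun o => .var _))
          ((dfn_rel₂ he Rel.lt).app (.var _) (.var _))))), fun y => ?_⟩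
      simp only [hG', he.injective.eq_iff, BoundedFormula.Realize, exists_eq_left]
      simp only [exists_and_left, exists_eq_left']
      apply iff_of_eq
      congr 1
      ext i; fin_cases i <;> rfl
  | imp φ ψ ih ih' =>
    obtain ⟨P, hP, hP'⟩ := ih
    obtain ⟨Q, hQ, hQ'⟩ := ih'
    exact ⟨fun v => P v → Q v, hP.imp hQ, fun y => by
      rw [BoundedFormula.realize_imp, ← hP', ← hQ']⟩
  | @all n φ ih =>
    obtain ⟨Q, hQ, hQ'⟩ := ih
    -- The last bound variable is the one being quantified and goes to `none`; all others keep their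
    -- place.
    let g : ι ⊕ Fin (n + 1) → Option (ι ⊕ Fin n) :=
      Sum.elim (fun i => some (Sum.inl i))
        (fun k => Fin.lastCases (motive := fun _ => Option (ι ⊕ Fin n)) none
          (fun k => some (Sum.inr k)) k)
    refine ⟨fun v => ∀ a, (∃ m, e m = a) → Q (fun s => (g s).elim a v),
      Dfn.all (Dfn.imp ((dfn_range he).app (.var _)) ?_), fun y => ?_⟩
    · refine (Dfn.comp hQ (f := fun s w => w (g s)) fun _ => .var _).congr fun w => ?_
      apply iff_of_eq
      congr 1
      ext s
      cases g s <;> rfl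
    · rw [BoundedFormula.realize_all]
      simp only [forall_exists_index, forall_apply_eq_imp_iff]
      refine forall_congr' fun m => ?_
      have := hQ' (fun s => (g s).elim m y)
      refine Iff.trans (iff_of_eq ?_) (this.trans (iff_of_eq ?_))
      · congr 1
        ext s
        cases g s <;> rfl
      · congr 1
        ext k
        refine Fin.lastCases ?_ (fun k => ?_) k <;> simp [g]

/-- The pullback along an interpretation of a definable predicate is the restriction of a definable
predicate. -/
theorem exists_translation (he : Solidity.IsInterpretation LangT LangT e) {ι : Type}
    {P : (ι → N) → Prop} (hP : Dfn P) :
    ∃ Q : (ι → M) → Prop, Dfn Q ∧ ∀ y : ι → N, Q (fun k => e (y k)) ↔ P y := by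
  obtain ⟨φ, h⟩ := hP
  obtain ⟨Q, hQ, hQ'⟩ := exists_boundedFormula_translation he φ
  refine ⟨fun v => Q (fun s => v (s.elim id finZeroElim)),
    Dfn.comp hQ fun _ => .var _, fun y => ?_⟩
  refine (hQ' (fun s => y (s.elim id finZeroElim))).trans (Iff.trans (iff_of_eq ?_) (h y))
  rw [Formula.Realize]
  congr 1
  exact Subsingleton.elim _ _

theorem exists_translation₂ (he : Solidity.IsInterpretation LangT LangT e)
    {P : N → N → Prop} (hP : Dfn₂ P) :
    ∃ Q : M → M → Prop, Dfn₂ Q ∧ ∀ x y, Q (e x) (e y) ↔ P x y := by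
  obtain ⟨Q, hQ, hQ'⟩ := exists_translation he hP
  refine ⟨fun a b => Q ![a, b], hQ.congr fun v => ?_, fun x y => ?_⟩
  · change Q v ↔ Q ![v 0, v 1]
    rw [show ![v 0, v 1] = v by ext i; fin_cases i <;> rfl]
  · refine Iff.trans (iff_of_eq ?_) (hQ' ![x, y])
    change Q ![e x, e y] = Q _
    congr 1
    ext i; fin_cases i <;> rfl

end Translation

/-! ### Semantics of the formula constructors -/

section Semantics

variable {M : Type w} [LangT.Structure M] {α : Type}

@[simp]
theorem realize_all' [DecidableEq α] (i : α) (φ : LangT.Formula α) (v : α → M) :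
    (all i φ).Realize v ↔ ∀ a, φ.Realize (Function.update v i a) := by
  rw [all, Formula.Realize, BoundedFormula.realize_all]
  refine forall_congr' fun a => ?_
  rw [BoundedFormula.realize_relabel, Formula.Realize]
  apply iff_of_eq
  congr 1
  · ext j
    by_cases h : j = i
    · subst h; simp [Fin.snoc]
    · simp [h]
  · exact Subsingleton.elim _ _

@[simp]
theorem realize_ex' [DecidableEq α] (i : α) (φ : LangT.Formula α) (v : α → M) :
    (ex i φ).Realize v ↔ ∃ a, φ.Realize (Function.update v i a) := by
  rw [ex, Formula.realize_not, realize_all']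
  simp only [Formula.realize_not]
  push Not
  rfl

@[simp]
theorem realize_substVar [DecidableEq α] (i : α) (t : LangT.Term α) (φ : LangT.Formula α)
    (v : α → M) :
    (substVar i t φ).Realize v ↔ φ.Realize (Function.update v i (t.realize v)) := by
  rw [substVar, Formula.Realize, BoundedFormula.realize_subst, Formula.Realize]
  apply iff_of_eq
  congr 1
  ext j
  by_cases h : j = i
  · subst h; simp
  · simp [h]

@[simp]
theorem realize_app (φ : Fm) (l : List Tm) (v : ℕ → M) :
    (app φ l).Realize v ↔ φ.Realize (fun i => (l.getD i zero).realize v) := by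
  rw [app, Formula.Realize, BoundedFormula.realize_subst, Formula.Realize]

theorem realize_toSentence (φ : Fm) :
    M ⊨ toSentence φ ↔
      φ.Realize (fun _ => (zero : LangT.Term Empty).realize (default : Empty → M)) := by
  rw [toSentence, Sentence.Realize, Formula.Realize, BoundedFormula.realize_subst, Formula.Realize]

@[simp]
theorem realize_alls_nil (φ : Fm) (v : ℕ → M) : (alls [] φ).Realize v ↔ φ.Realize v := Iff.rfl

@[simp]
theorem realize_alls_cons (i : ℕ) (l : List ℕ) (φ : Fm) (v : ℕ → M) :
    (alls (i :: l) φ).Realize v ↔ ∀ a, (alls l φ).Realize (Function.update v i a) :=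
  realize_all' i _ v

@[simp]
theorem realize_exs_nil (φ : Fm) (v : ℕ → M) : (exs [] φ).Realize v ↔ φ.Realize v := Iff.rfl

@[simp]
theorem realize_exs_cons (i : ℕ) (l : List ℕ) (φ : Fm) (v : ℕ → M) :
    (exs (i :: l) φ).Realize v ↔ ∃ a, (exs l φ).Realize (Function.update v i a) :=
  realize_ex' i _ v

@[simp]
theorem realize_eq' (s t : LangT.Term α) (v : α → M) :
    (eq s t).Realize v ↔ s.realize v = t.realize v := by
  rw [eq, Formula.realize_equal]

@[simp]
theorem realize_x (i : ℕ) (v : ℕ → M) : (x i).realize v = v i := rfl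

theorem induction_of_formula [hM : M ⊨ PAT] {n : ℕ} (φ : LangT.Formula (Fin (n + 1)))
    (v : Fin (n + 1) → M)
    (h0 : φ.Realize (Function.update v 0 (Structure.funMap (L := LangT) Func.zero ![])))
    (hs : ∀ a, φ.Realize (Function.update v 0 a) →
      φ.Realize (Function.update v 0 (Structure.funMap (L := LangT) Func.succ ![a]))) (a : M) :
    φ.Realize (Function.update v 0 a) := by
  have h : M ⊨ inductionAxiom φ := PAT.realize_sentence_of_mem (Or.inr ⟨n, φ, rfl⟩)
  rw [inductionAxiom, Sentence.Realize, Formula.realize_iAlls] at h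
  have h' := h v
  rw [Formula.realize_relabel, Formula.realize_imp, Formula.realize_inf, realize_all', realize_all',
    realize_substVar] at h'
  simp only [Formula.realize_imp, realize_substVar, Sum.elim_comp_inr] at h'
  refine h' ⟨?_, fun b hb => ?_⟩ a
  · convert h0
    simp [zero]
    congr 1
    exact Subsingleton.elim _ _
  · convert hs b hb using 1
    rw [Function.update_idem, succ, Term.realize_func]
    congr 2
    ext i; fin_cases i; simp

theorem induction_of_dfn [hM : M ⊨ PAT] {P : M → Prop} (hP : Dfn₁ P)
    (h0 : P (Structure.funMap (L := LangT) Func.zero ![]))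
    (hs : ∀ a, P a → P (Structure.funMap (L := LangT) Func.succ ![a])) (a : M) : P a := by
  -- The axiom scheme has only finitely many variables and no names for elements. A definition uses
  -- a finite set `A` of parameters; these become the variables `1, …, A.card`, and variable `0` is
  -- the one of the induction.
  obtain ⟨A, -, hA⟩ := Set.definable_iff_finitely_definable.1 (dfn_iff_definable.1 hP)
  obtain ⟨φ, hφ⟩ := Set.definable_iff_exists_formula_sum.1 hA
  let E : (A : Set M) ≃ Fin A.card := A.equivFin
  let g : (A : Set M) ⊕ Fin 1 → Fin (A.card + 1) := Sum.elim (fun a => (E a).succ) (fun _ => 0)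
  let v : Fin (A.card + 1) → M := Fin.cons a (fun i => (E.symm i : M))
  have key : ∀ b, (φ.relabel g).Realize (Function.update v 0 b) ↔ P b := fun b => by
    have := Set.ext_iff.1 hφ ![b]
    rw [Set.mem_ofPred_eq, Set.mem_ofPred_eq] at this
    refine Iff.trans ?_ this.symm
    rw [Formula.realize_relabel]
    apply iff_of_eq
    congr 1
    ext (c | c)
    · simp [g, v]
    · simp [g]
  rw [← key]
  exact induction_of_formula _ v ((key _).2 h0) (fun b hb => (key _).2 (hs b ((key _).1 hb))) a

end Semantics

/-! ### The ordered semiring of a model of `PA(T)` -/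

section Arithmetic

variable {M : Type w} [LangT.Structure M]

variable (M) in
/-- The interpretation of `0`. -/
def zeroOf : M := Structure.funMap (L := LangT) Func.zero ![]

/-- The interpretation of `S`. -/
def succOf (a : M) : M := Structure.funMap (L := LangT) Func.succ ![a]

/-- The interpretation of `+`. -/
def addOf (a b : M) : M := Structure.funMap (L := LangT) Func.add ![a, b]

/-- The interpretation of `·`. -/
def mulOf (a b : M) : M := Structure.funMap (L := LangT) Func.mul ![a, b]

/-- The interpretation of `<`. -/
def ltOf (a b : M) : Prop := Structure.RelMap (L := LangT) Rel.lt ![a, b]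

/-- The interpretation of `T`. -/
def trOf (a : M) : Prop := Structure.RelMap (L := LangT) Rel.tr ![a]

section

variable {α : Type} (v : α → M) (s t : LangT.Term α)

@[simp]
theorem realize_zero' : (zero : LangT.Term α).realize v = zeroOf M := by
  rw [zero, zeroOf, Term.realize_func]
  congr 1
  exact Subsingleton.elim _ _

@[simp]
theorem realize_succ' : (succ s).realize v = succOf (s.realize v) := by
  rw [succ, succOf, Term.realize_func]
  congr 1
  ext i; fin_cases i; rfl

@[simp]
theorem realize_add' : (add s t).realize v = addOf (s.realize v) (t.realize v) := by
  rw [add, addOf, Term.realize_func]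
  congr 1
  ext i; fin_cases i <;> rfl

@[simp]
theorem realize_mul' : (mul s t).realize v = mulOf (s.realize v) (t.realize v) := by
  rw [mul, mulOf, Term.realize_func]
  congr 1
  ext i; fin_cases i <;> rfl

@[simp]
theorem realize_lt' : (lt s t).Realize v ↔ ltOf (s.realize v) (t.realize v) := by
  rw [lt, ltOf, Formula.realize_rel]
  apply iff_of_eq
  congr 1
  ext i; fin_cases i <;> rfl

@[simp]
theorem realize_tr' : (tr s).Realize v ↔ trOf (s.realize v) := by
  rw [tr, trOf, Formula.realize_rel]
  apply iff_of_eq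
  congr 1
  ext i; fin_cases i; rfl

end

section

variable {ι : Type} {f g : (ι → M) → M}

theorem Tdf.succOf (hf : Tdf f) : Tdf (fun v => succOf (f v)) := by
  obtain ⟨t, h⟩ := Tdf.func (Func.succ : LangT.Functions 1) (f := ![f]) (by simpa using hf)
  refine ⟨t, fun v => (h v).trans (congrArg _ ?_)⟩
  ext i; fin_cases i; rfl

theorem Tdf.addOf (hf : Tdf f) (hg : Tdf g) : Tdf (fun v => addOf (f v) (g v)) := by
  obtain ⟨t, h⟩ := Tdf.func (Func.add : LangT.Functions 2) (f := ![f, g])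
    (by simp [Fin.forall_fin_two, hf, hg])
  refine ⟨t, fun v => (h v).trans (congrArg _ ?_)⟩
  ext i; fin_cases i <;> rfl

theorem Tdf.mulOf (hf : Tdf f) (hg : Tdf g) : Tdf (fun v => mulOf (f v) (g v)) := by
  obtain ⟨t, h⟩ := Tdf.func (Func.mul : LangT.Functions 2) (f := ![f, g])
    (by simp [Fin.forall_fin_two, hf, hg])
  refine ⟨t, fun v => (h v).trans (congrArg _ ?_)⟩
  ext i; fin_cases i <;> rfl

theorem Dfn.ltOf (hf : Tdf f) (hg : Tdf g) : Dfn (fun v => ltOf (f v) (g v)) := by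
  refine (Dfn.rel (Rel.lt : LangT.Relations 2) (f := ![f, g])
    (by simp [Fin.forall_fin_two, hf, hg])).congr fun v => iff_of_eq (congrArg _ ?_)
  ext i; fin_cases i <;> rfl

theorem Dfn.trOf (hf : Tdf f) : Dfn (fun v => trOf (f v)) := by
  refine (Dfn.rel (Rel.tr : LangT.Relations 1) (f := ![f])
    (by simpa using hf)).congr fun v => iff_of_eq (congrArg _ ?_)
  ext i; fin_cases i; rfl

end

variable [hM : M ⊨ PAT]

theorem realize_robinson {φ : Fm} (h : toSentence φ ∈ robinson) :
    φ.Realize (fun _ => zeroOf M) := by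
  have := (realize_toSentence φ).1 (PAT.realize_sentence_of_mem (M := M) (Or.inl h))
  rwa [realize_zero'] at this

theorem succOf_ne_zeroOf (a : M) : succOf a ≠ zeroOf M := by
  have := realize_robinson (M := M) (φ := alls [0] (eq (succ (x 0)) zero).not) (by simp [robinson])
  simp at this
  exact this a

theorem succOf_injective : Function.Injective (succOf (M := M)) := fun a b => by
  have := realize_robinson (M := M)
    (φ := alls [0, 1] ((eq (succ (x 0)) (succ (x 1))).imp (eq (x 0) (x 1)))) (by simp [robinson])
  simp at this
  exact this a b

theorem addOf_zeroOf (a : M) : addOf a (zeroOf M) = a := by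
  have := realize_robinson (M := M)
    (φ := alls [0] (eq (add (x 0) zero) (x 0))) (by simp [robinson])
  simp at this
  exact this a

theorem addOf_succOf (a b : M) : addOf a (succOf b) = succOf (addOf a b) := by
  have := realize_robinson (M := M)
    (φ := alls [0, 1] (eq (add (x 0) (succ (x 1))) (succ (add (x 0) (x 1))))) (by simp [robinson])
  simp at this
  exact this a b

theorem mulOf_zeroOf (a : M) : mulOf a (zeroOf M) = zeroOf M := by
  have := realize_robinson (M := M)
    (φ := alls [0] (eq (mul (x 0) zero) zero)) (by simp [robinson])
  simp at this
  exact this a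

theorem mulOf_succOf (a b : M) : mulOf a (succOf b) = addOf (mulOf a b) a := by
  have := realize_robinson (M := M)
    (φ := alls [0, 1] (eq (mul (x 0) (succ (x 1))) (add (mul (x 0) (x 1)) (x 0))))
    (by simp [robinson])
  simp at this
  exact this a b

theorem ltOf_iff (a b : M) : ltOf a b ↔ ∃ c, addOf a (succOf c) = b := by
  have := realize_robinson (M := M)
    (φ := alls [0, 1] ((lt (x 0) (x 1)).iff (exs [2] (eq (add (x 0) (succ (x 2))) (x 1)))))
    (by simp [robinson])
  simp at this
  exact this a b

theorem addOf_assoc (a b c : M) : addOf (addOf a b) c = addOf a (addOf b c) := by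
  refine induction_of_dfn (P := fun c => addOf (addOf a b) c = addOf a (addOf b c)) ?_ ?_ ?_ c
  · exact Dfn.eq (.addOf (.const _) (.var _)) (.addOf (.const _) (.addOf (.const _) (.var _)))
  · change addOf _ (zeroOf M) = addOf _ (addOf _ (zeroOf M))
    simp only [addOf_zeroOf]
  · intro c hc
    change addOf _ (succOf c) = addOf _ (addOf _ (succOf c))
    simp only [addOf_succOf, hc]

theorem zeroOf_addOf (a : M) : addOf (zeroOf M) a = a := by
  refine induction_of_dfn (P := fun a => addOf (zeroOf M) a = a) ?_ ?_ ?_ a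
  · exact Dfn.eq (.addOf (.const _) (.var _)) (.var _)
  · exact addOf_zeroOf _
  · intro c hc
    change addOf _ (succOf c) = succOf c
    rw [addOf_succOf, hc]

theorem succOf_addOf (a b : M) : addOf (succOf a) b = succOf (addOf a b) := by
  refine induction_of_dfn (P := fun b => addOf (succOf a) b = succOf (addOf a b)) ?_ ?_ ?_ b
  · exact Dfn.eq (.addOf (.const _) (.var _)) (.succOf (.addOf (.const _) (.var _)))
  · change addOf _ (zeroOf M) = succOf (addOf _ (zeroOf M))
    simp only [addOf_zeroOf]
  · intro c hc
    change addOf _ (succOf c) = succOf (addOf _ (succOf c))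
    simp only [addOf_succOf, hc]

theorem addOf_comm (a b : M) : addOf a b = addOf b a := by
  refine induction_of_dfn (P := fun b => addOf a b = addOf b a) ?_ ?_ ?_ b
  · exact Dfn.eq (.addOf (.const _) (.var _)) (.addOf (.var _) (.const _))
  · exact (addOf_zeroOf a).trans (zeroOf_addOf a).symm
  · intro c hc
    change addOf a (succOf c) = addOf (succOf c) a
    rw [addOf_succOf, hc, succOf_addOf]

theorem mulOf_addOf (a b c : M) : mulOf a (addOf b c) = addOf (mulOf a b) (mulOf a c) := by
  refine induction_of_dfn (P := fun c => mulOf a (addOf b c) = addOf (mulOf a b) (mulOf a c))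
    ?_ ?_ ?_ c
  · exact Dfn.eq (.mulOf (.const _) (.addOf (.const _) (.var _)))
      (.addOf (.const _) (.mulOf (.const _) (.var _)))
  · change mulOf a (addOf b (zeroOf M)) = addOf (mulOf a b) (mulOf a (zeroOf M))
    simp only [addOf_zeroOf, mulOf_zeroOf]
  · intro c hc
    change mulOf a (addOf b (succOf c)) = addOf (mulOf a b) (mulOf a (succOf c))
    rw [addOf_succOf, mulOf_succOf, hc, mulOf_succOf, addOf_assoc]

theorem zeroOf_mulOf (a : M) : mulOf (zeroOf M) a = zeroOf M := by
  refine induction_of_dfn (P := fun a => mulOf (zeroOf M) a = zeroOf M) ?_ ?_ ?_ a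
  · exact Dfn.eq (.mulOf (.const _) (.var _)) (.const _)
  · exact mulOf_zeroOf _
  · intro c hc
    change mulOf _ (succOf c) = _
    rw [mulOf_succOf, hc, addOf_zeroOf]

theorem succOf_mulOf (a b : M) : mulOf (succOf a) b = addOf (mulOf a b) b := by
  refine induction_of_dfn (P := fun b => mulOf (succOf a) b = addOf (mulOf a b) b) ?_ ?_ ?_ b
  · exact Dfn.eq (.mulOf (.const _) (.var _)) (.addOf (.mulOf (.const _) (.var _)) (.var _))
  · change mulOf _ (zeroOf M) = addOf (mulOf _ (zeroOf M)) (zeroOf M)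
    simp only [addOf_zeroOf, mulOf_zeroOf]
  · intro c hc
    change mulOf _ (succOf c) = addOf (mulOf _ (succOf c)) (succOf c)
    rw [mulOf_succOf, mulOf_succOf, hc, addOf_succOf, addOf_succOf, addOf_assoc, addOf_assoc,
      addOf_comm c a]

theorem mulOf_comm (a b : M) : mulOf a b = mulOf b a := by
  refine induction_of_dfn (P := fun b => mulOf a b = mulOf b a) ?_ ?_ ?_ b
  · exact Dfn.eq (.mulOf (.const _) (.var _)) (.mulOf (.var _) (.const _))
  · exact (mulOf_zeroOf a).trans (zeroOf_mulOf a).symm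
  · intro c hc
    change mulOf a (succOf c) = mulOf (succOf c) a
    rw [mulOf_succOf, hc, succOf_mulOf]

theorem mulOf_assoc (a b c : M) : mulOf (mulOf a b) c = mulOf a (mulOf b c) := by
  refine induction_of_dfn (P := fun c => mulOf (mulOf a b) c = mulOf a (mulOf b c)) ?_ ?_ ?_ c
  · exact Dfn.eq (.mulOf (.const _) (.var _)) (.mulOf (.const _) (.mulOf (.const _) (.var _)))
  · change mulOf _ (zeroOf M) = mulOf _ (mulOf _ (zeroOf M))
    simp only [mulOf_zeroOf]
  · intro c hc
    change mulOf _ (succOf c) = mulOf _ (mulOf _ (succOf c))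
    simp only [mulOf_succOf, hc, mulOf_addOf]

theorem mulOf_one (a : M) : mulOf a (succOf (zeroOf M)) = a := by
  rw [mulOf_succOf, mulOf_zeroOf, zeroOf_addOf]

noncomputable instance : CommSemiring M where
  add := addOf
  add_assoc := addOf_assoc
  zero := zeroOf M
  zero_add := zeroOf_addOf
  add_zero := addOf_zeroOf
  add_comm := addOf_comm
  mul := mulOf
  left_distrib := mulOf_addOf
  right_distrib a b c := by
    change mulOf (addOf a b) c = addOf (mulOf a c) (mulOf b c)
    rw [mulOf_comm, mulOf_addOf, mulOf_comm c a, mulOf_comm c b]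
  zero_mul := zeroOf_mulOf
  mul_zero := mulOf_zeroOf
  mul_assoc := mulOf_assoc
  one := succOf (zeroOf M)
  one_mul a := (mulOf_comm _ _).trans (mulOf_one a)
  mul_one := mulOf_one
  mul_comm := mulOf_comm
  nsmul := @nsmulRec M ⟨zeroOf M⟩ ⟨addOf⟩
  npow := @npowRec M ⟨succOf (zeroOf M)⟩ ⟨mulOf⟩

theorem zeroOf_eq : zeroOf M = 0 := rfl

theorem addOf_eq (a b : M) : addOf a b = a + b := rfl

theorem mulOf_eq (a b : M) : mulOf a b = a * b := rfl

theorem succOf_eq (a : M) : succOf a = a + 1 := by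
  change _ = addOf a (succOf (zeroOf M))
  rw [addOf_succOf, addOf_zeroOf]

theorem Tdf.add {ι : Type} {f g : (ι → M) → M} (hf : Tdf f) (hg : Tdf g) :
    Tdf (fun v => f v + g v) := Tdf.addOf hf hg

theorem Tdf.mul {ι : Type} {f g : (ι → M) → M} (hf : Tdf f) (hg : Tdf g) :
    Tdf (fun v => f v * g v) := Tdf.mulOf hf hg

/-- Induction for definable predicates. -/
theorem dfn_induction {P : M → Prop} (hP : Dfn₁ P) (h0 : P 0) (hs : ∀ a, P a → P (a + 1)) (a : M) :
    P a :=
  induction_of_dfn hP h0 (fun a ha => by have := hs a ha; rwa [← succOf_eq] at this) a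

theorem add_one_ne_zero' (a : M) : a + 1 ≠ 0 := by
  rw [← succOf_eq]
  exact succOf_ne_zeroOf a

theorem eq_of_add_eq_add_right (a b c : M) : a + c = b + c → a = b := by
  refine dfn_induction (P := fun c => a + c = b + c → a = b) ?_ ?_ ?_ c
  · exact Dfn.imp (Dfn.eq (.add (.const _) (.var _)) (.add (.const _) (.var _)))
      (Dfn.eq (.const _) (.const _))
  · simp
  · intro c hc h
    rw [← add_assoc, ← add_assoc, ← succOf_eq, ← succOf_eq] at h
    exact hc (succOf_injective h)

theorem eq_zero_or_eq_add_one (a : M) : a = 0 ∨ ∃ b, a = b + 1 := by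
  refine dfn_induction (P := fun a => a = 0 ∨ ∃ b, a = b + 1) ?_ ?_ ?_ a
  · exact Dfn.or (Dfn.eq (.var _) (.const _)) (Dfn.ex (Dfn.eq (.var _) (.add (.var _) (.const _))))
  · exact Or.inl rfl
  · exact fun a _ => Or.inr ⟨a, rfl⟩

theorem eq_zero_of_add_eq_zero (a b : M) (h : a + b = 0) : b = 0 := by
  rcases eq_zero_or_eq_add_one b with h' | ⟨c, rfl⟩
  · exact h'
  · rw [← add_assoc] at h
    exact absurd h (add_one_ne_zero' _)

theorem exists_add_total (a b : M) : (∃ c, a + c = b) ∨ ∃ c, b + c = a := by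
  refine dfn_induction (P := fun b => (∃ c, a + c = b) ∨ ∃ c, b + c = a) ?_ ?_ ?_ b
  · exact Dfn.or (Dfn.ex (Dfn.eq (.add (.const _) (.var _)) (.var _)))
      (Dfn.ex (Dfn.eq (.add (.var _) (.var _)) (.const _)))
  · exact Or.inr ⟨a, zero_add a⟩
  · rintro b (⟨c, rfl⟩ | ⟨c, rfl⟩)
    · exact Or.inl ⟨c + 1, by rw [add_assoc]⟩
    · rcases eq_zero_or_eq_add_one c with rfl | ⟨d, rfl⟩
      · exact Or.inl ⟨1, by rw [add_zero]⟩
      · exact Or.inr ⟨d, by ring⟩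

theorem ltOf_iff_add_one (a b : M) : ltOf a b ↔ ∃ c, a + (c + 1) = b := by
  rw [ltOf_iff]
  simp only [succOf_eq, addOf_eq]

/-- Taking the interpreted symbol itself as `<` makes formulas and order agree by definition, while
`≤` as existence of a difference makes the order canonical for the addition. -/
noncomputable instance : LinearOrder M where
  le a b := ∃ c, a + c = b
  lt := ltOf
  le_refl a := ⟨0, add_zero a⟩
  le_trans a b c := by
    rintro ⟨d, rfl⟩ ⟨d', rfl⟩
    exact ⟨d + d', (add_assoc _ _ _).symm⟩
  lt_iff_le_not_ge a b := by
    rw [ltOf_iff_add_one]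
    constructor
    · rintro ⟨c, rfl⟩
      refine ⟨⟨c + 1, rfl⟩, ?_⟩
      rintro ⟨d, h⟩
      refine add_one_ne_zero' (d + c) (eq_of_add_eq_add_right _ _ a ?_)
      rw [zero_add]
      refine Eq.trans ?_ h
      ring
    · rintro ⟨⟨c, rfl⟩, h⟩
      rcases eq_zero_or_eq_add_one c with rfl | ⟨d, rfl⟩
      · exact absurd ⟨0, by simp⟩ h
      · exact ⟨d, rfl⟩
  le_antisymm a b := by
    rintro ⟨c, rfl⟩ ⟨d, h⟩
    have : c + d = 0 := by
      refine eq_of_add_eq_add_right _ _ a ?_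
      rw [zero_add]
      refine Eq.trans ?_ h
      ring
    rw [add_comm] at this
    rw [eq_zero_of_add_eq_zero _ _ this, add_zero]
  le_total := exists_add_total
  toDecidableLE := Classical.decRel _

theorem ltOf_eq (a b : M) : ltOf a b ↔ a < b := Iff.rfl

instance : IsOrderedCancelAddMonoid M where
  add_le_add_left a b h c := by
    obtain ⟨d, rfl⟩ := h
    exact ⟨d, by ring⟩
  le_of_add_le_add_left a b c h := by
    obtain ⟨d, h⟩ := h
    refine ⟨d, eq_of_add_eq_add_right _ _ a ?_⟩
    rw [add_comm c a, ← h]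
    ring

instance : CanonicallyOrderedAdd M where
  exists_add_of_le h := by
    obtain ⟨c, rfl⟩ := h
    exact ⟨c, rfl⟩
  le_add_self a b := ⟨b, add_comm _ _⟩
  le_self_add a b := ⟨b, rfl⟩

instance : Nontrivial M := ⟨⟨0 + 1, 0, add_one_ne_zero' 0⟩⟩

theorem mul_pos_of_pos (a b : M) (ha : 0 < a) (hb : 0 < b) : 0 < a * b := by
  rcases eq_zero_or_eq_add_one a with rfl | ⟨a, rfl⟩
  · exact absurd ha (lt_irrefl _)
  rcases eq_zero_or_eq_add_one b with rfl | ⟨b, rfl⟩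
  · exact absurd hb (lt_irrefl _)
  rw [pos_iff_ne_zero, show (a + 1) * (b + 1) = a * b + a + b + 1 by ring]
  exact add_one_ne_zero' _

instance : IsStrictOrderedRing M :=
  { (inferInstance : IsOrderedCancelAddMonoid M), (inferInstance : Nontrivial M) with
    zero_le_one := zero_le
    mul_lt_mul_of_pos_left := fun a ha b c h => by
      obtain ⟨d, rfl⟩ := exists_add_of_le h.le
      have hd : 0 < d := by
        rw [pos_iff_ne_zero]
        rintro rfl
        simp at h
      rw [mul_add]
      exact lt_add_of_pos_right _ (mul_pos_of_pos _ _ ha hd)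
    mul_lt_mul_of_pos_right := fun a ha b c h => by
      obtain ⟨d, rfl⟩ := exists_add_of_le h.le
      have hd : 0 < d := by
        rw [pos_iff_ne_zero]
        rintro rfl
        simp at h
      rw [add_mul]
      exact lt_add_of_pos_right _ (mul_pos_of_pos _ _ hd ha) }

theorem Dfn.lt {ι : Type} {f g : (ι → M) → M} (hf : Tdf f) (hg : Tdf g) :
    Dfn (fun v => f v < g v) := Dfn.ltOf hf hg

theorem Dfn.le {ι : Type} {f g : (ι → M) → M} (hf : Tdf f) (hg : Tdf g) :
    Dfn (fun v => f v ≤ g v) := (Dfn.lt hg hf).not.congr fun _ => not_lt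

theorem lt_add_one_iff' (a b : M) : a < b + 1 ↔ a ≤ b := by
  constructor
  · intro h
    by_contra! h'
    obtain ⟨c, rfl⟩ := (ltOf_iff_add_one _ _).1 h'
    refine absurd h (not_lt.2 ?_)
    rw [← add_assoc, add_right_comm]
    exact le_self_add
  · exact fun h => lt_of_le_of_lt h (lt_add_one b)

/-- Strong induction for definable predicates. -/
theorem dfn_strong_induction {P : M → Prop} (hP : Dfn₁ P) (h : ∀ a, (∀ b < a, P b) → P a) (a : M) :
    P a := by
  refine h a (dfn_induction (P := fun a => ∀ b < a, P b) ?_ ?_ ?_ a)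
  · exact Dfn.all (Dfn.imp (Dfn.lt (.var _) (.var _)) (Dfn₁.app hP (.var _)))
  · exact fun b hb => absurd hb not_lt_zero
  · intro a ha b hb
    rcases ((lt_add_one_iff' b a).1 hb).lt_or_eq with hb | rfl
    · exact ha b hb
    · exact h _ ha

end Arithmetic

/-! ### Pairs and coded sets, semantically -/

section Codes

variable {M : Type w} [CommSemiring M] [LT M]

/-- `z` is the Cantor pair of `s` and `t`. -/
def IsPair (z s t : M) : Prop := z + z = (s + t) * (s + t + 1) + (t + t)

/-- `s` belongs to the finite set coded by `a, b, m`. -/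
def Mem (s a b m : M) : Prop := (s < m ∨ s = m) ∧ ∃ q, a = q * ((s + 1) * b + 1)

/-- The pair of `s` and `t` belongs to the finite set coded by `a, b, m`. -/
def PairMem (s t a b m : M) : Prop := ∃ z, IsPair z s t ∧ Mem z a b m

end Codes

/-! ### Cantor pairing and comprehension for bounded definable sets in a model of `PA(T)`. -/

section Coding

variable {M : Type w} [LangT.Structure M] [M ⊨ PAT]

theorem Dfn.isPair {ι : Type} {f g h : (ι → M) → M} (hf : Tdf f) (hg : Tdf g) (hh : Tdf h) :
    Dfn (fun v => IsPair (f v) (g v) (h v)) :=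
  Dfn.eq (hf.add hf) (((hg.add hh).mul ((hg.add hh).add (.const _))).add (hh.add hh))

theorem Dfn.mem {ι : Type} {f g h k : (ι → M) → M} (hf : Tdf f) (hg : Tdf g) (hh : Tdf h)
    (hk : Tdf k) : Dfn (fun v => Mem (f v) (g v) (h v) (k v)) :=
  Dfn.and (Dfn.or (Dfn.lt hf hk) (Dfn.eq hf hk)) (Dfn.ex (Dfn.eq hg.weaken
    (Tdf.mul (.var _) (((hf.weaken.add (.const _)).mul hh.weaken).add (.const _)))))

theorem Dfn.pairMem {ι : Type} {f g h k l : (ι → M) → M} (hf : Tdf f) (hg : Tdf g) (hh : Tdf h)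
    (hk : Tdf k) (hl : Tdf l) : Dfn (fun v => PairMem (f v) (g v) (h v) (k v) (l v)) :=
  Dfn.ex (Dfn.and (Dfn.isPair (.var _) hf.weaken hg.weaken)
    (Dfn.mem (.var _) hh.weaken hk.weaken hl.weaken))

theorem one_le_of_pos {a : M} (h : 0 < a) : 1 ≤ a := by
  rcases eq_zero_or_eq_add_one a with rfl | ⟨b, rfl⟩
  · exact absurd h (lt_irrefl _)
  · exact le_add_self

theorem add_one_le_of_lt {a b : M} (h : a < b) : a + 1 ≤ b := by
  by_contra! h'
  exact absurd ((lt_add_one_iff' _ _).1 h') (not_le.2 h)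

theorem le_of_add_self_le {a b : M} (h : a + a ≤ b + b) : a ≤ b := by
  by_contra! h'
  exact absurd h (not_le.2 (add_lt_add h' h'))

theorem exists_isPair (s t : M) : ∃ z, IsPair z s t := by
  -- Division by two is unavailable, so the evenness of `w (w + 1)` is proved by induction.
  have key : ∀ w : M, ∃ z, z + z = w * (w + 1) := by
    refine dfn_induction ?_ ⟨0, by simp⟩ ?_
    · exact Dfn.ex (Dfn.eq (.add (.var _) (.var _)) (.mul (.var _) (.add (.var _) (.const _))))
    · rintro w ⟨z, hz⟩
      refine ⟨z + (w + 1), ?_⟩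
      rw [show z + (w + 1) + (z + (w + 1)) = (z + z) + (w + 1 + (w + 1)) by ring, hz]
      ring
  obtain ⟨z, hz⟩ := key (s + t)
  refine ⟨z + t, ?_⟩
  rw [IsPair, ← hz]
  ring

theorem IsPair.add_le {z s t : M} (h : IsPair z s t) : s + t ≤ z := by
  refine le_of_add_self_le ?_
  rw [show z + z = (s + t) * (s + t + 1) + (t + t) from h]
  refine le_trans ?_ le_self_add
  rcases eq_zero_or_eq_add_one (s + t) with h | ⟨b, h⟩
  · simp [h]
  · rw [h, show (b + 1) * (b + 1 + 1) = (b + 1 + (b + 1)) + (b + 1) * b by ring]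
    exact le_self_add

/-- Codes enumerate the diagonals `s + t = w` one after the other: with `t ≤ w`, twice a code on
diagonal `w` is at most `w (w + 1) + 2 w`, which is below `(w + 1) (w + 2)`. Hence a code determines
its diagonal, and then the pair. -/
theorem IsPair.lt_of_add_lt {z s t z' s' t' : M} (h : IsPair z s t) (h' : IsPair z' s' t')
    (hlt : s + t < s' + t') : z < z' := by
  by_contra! hle
  have h1 : z' + z' ≤ z + z := add_le_add hle hle
  rw [show z + z = (s + t) * (s + t + 1) + (t + t) from h,
    show z' + z' = (s' + t') * (s' + t' + 1) + (t' + t') from h'] at h1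
  obtain ⟨c, hc⟩ := exists_add_of_le (add_one_le_of_lt hlt)
  rw [hc] at h1
  have h2 : (s + t) * (s + t + 1) + (t + t) <
      (s + t + 1 + c) * (s + t + 1 + c + 1) + (t' + t') := by
    refine lt_of_lt_of_le (lt_add_one _) ?_
    rw [show (s + t + 1 + c) * (s + t + 1 + c + 1) + (t' + t') =
      (s + t) * (s + t + 1) + (t + t) + 1 + (1 + s + s + c * (s + t + 1 + c + 1) + c * (s + t + 1)
        + (t' + t')) by ring]
    exact le_self_add
  exact absurd h1 (not_le.2 h2)

theorem IsPair.eq {z s t z' s' t' : M} (h : IsPair z s t) (h' : IsPair z' s' t') (hz : z = z') :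
    s = s' ∧ t = t' := by
  subst hz
  have hw : s + t = s' + t' := by
    rcases lt_trichotomy (s + t) (s' + t') with hlt | heq | hlt
    · exact absurd (h.lt_of_add_lt h' hlt) (lt_irrefl _)
    · exact heq
    · exact absurd (h'.lt_of_add_lt h hlt) (lt_irrefl _)
  have h2 := Eq.trans (Eq.symm h) h'
  rw [hw] at h2
  have ht : t + t = t' + t' := add_left_cancel h2
  have ht : t = t' := le_antisymm (le_of_add_self_le ht.le) (le_of_add_self_le ht.ge)
  subst ht
  exact ⟨add_right_cancel hw, rfl⟩

/-- Cantor's pairing function. -/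
noncomputable def pair (s t : M) : M := (exists_isPair s t).choose

theorem isPair_pair (s t : M) : IsPair (pair s t) s t := (exists_isPair s t).choose_spec

theorem isPair_iff {z s t : M} : IsPair z s t ↔ z = pair s t := by
  constructor
  · intro h
    refine le_antisymm ?_ ?_ <;> refine le_of_add_self_le (le_of_eq ?_)
    · exact Eq.trans h (isPair_pair s t).symm
    · exact Eq.trans (isPair_pair s t) h.symm
  · rintro rfl
    exact isPair_pair s t

theorem pair_inj {s t s' t' : M} : pair s t = pair s' t' ↔ s = s' ∧ t = t' :=
  ⟨fun h => (isPair_pair s t).eq (isPair_pair s' t') h, by rintro ⟨rfl, rfl⟩; rfl⟩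

theorem add_le_pair (s t : M) : s + t ≤ pair s t := (isPair_pair s t).add_le

theorem left_le_pair (s t : M) : s ≤ pair s t := le_self_add.trans (add_le_pair s t)

theorem right_le_pair (s t : M) : t ≤ pair s t := le_add_self.trans (add_le_pair s t)

theorem pair_le_pair {s t s' t' : M} (hs : s ≤ s') (ht : t ≤ t') : pair s t ≤ pair s' t' := by
  refine le_of_add_self_le ?_
  rw [show pair s t + pair s t = _ from isPair_pair s t,
    show pair s' t' + pair s' t' = _ from isPair_pair s' t']
  gcongr

theorem Dfn.eq_pair {ι : Type} {f g h : (ι → M) → M} (hf : Tdf f) (hg : Tdf g) (hh : Tdf h) :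
    Dfn (fun v => f v = pair (g v) (h v)) :=
  (Dfn.isPair hf hg hh).congr fun _ => isPair_iff

theorem mem_iff {s a b m : M} : Mem s a b m ↔ s ≤ m ∧ ((s + 1) * b + 1) ∣ a := by
  rw [Mem, le_iff_lt_or_eq]
  refine and_congr_right fun _ => exists_congr fun q => ?_
  rw [mul_comm]

theorem pairMem_iff {s t a b m : M} :
    PairMem s t a b m ↔ pair s t ≤ m ∧ ((pair s t + 1) * b + 1) ∣ a := by
  simp only [PairMem, isPair_iff, exists_eq_left, mem_iff]

theorem PairMem.left_le {s t a b m : M} (h : PairMem s t a b m) : s ≤ m :=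
  (left_le_pair s t).trans (pairMem_iff.1 h).1

theorem PairMem.right_le {s t a b m : M} (h : PairMem s t a b m) : t ≤ m :=
  (right_le_pair s t).trans (pairMem_iff.1 h).1

/-- Without subtraction, the quotients are compared; if that of the sum is not the larger one, then
`y = 0`. -/
theorem dvd_of_dvd_add {p x y : M} (hx : p ∣ x) (hxy : p ∣ x + y) : p ∣ y := by
  obtain ⟨u, rfl⟩ := hx
  obtain ⟨w, hw⟩ := hxy
  rcases le_total u w with h | h
  · obtain ⟨c, rfl⟩ := exists_add_of_le h
    rw [mul_add] at hw
    exact ⟨c, add_left_cancel hw⟩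
  · have : p * u + y ≤ p * u + 0 := by
      rw [hw, add_zero]
      exact mul_le_mul_right h p
    rw [nonpos_iff_eq_zero.1 (le_of_add_le_add_left this)]
    exact dvd_zero p

/-- The number `b` plays the role of `m!`. -/
theorem exists_common_multiple (m : M) : ∃ b, 0 < b ∧ ∀ d, d < m → (d + 1) ∣ b := by
  refine dfn_induction (P := fun m => ∃ b, 0 < b ∧ ∀ d, d < m → (d + 1) ∣ b) ?_ ?_ ?_ m
  · exact Dfn.ex (Dfn.and (Dfn.lt (.const _) (.var _)) (Dfn.all (Dfn.imp (Dfn.lt (.var _) (.var _))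
      (Dfn.ex (Dfn.eq (.var _) (.mul (.add (.var _) (.const _)) (.var _)))))))
  · exact ⟨1, zero_lt_one, fun d hd => absurd hd not_lt_zero⟩
  · rintro m ⟨b, hb0, hb⟩
    refine ⟨b * (m + 1), mul_pos hb0 (lt_of_le_of_lt zero_le (lt_add_one m)), fun d hd => ?_⟩
    rcases ((lt_add_one_iff' d m).1 hd).lt_or_eq with h | rfl
    · exact (hb d h).mul_right _
    · exact dvd_mul_left _ _

/-- The moduli `1 + (i + 1) b` and `1 + (k + 1) b` are coprime if the distance of `i` and `k`
divides `b`. -/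
theorem dvd_of_dvd_mul_modulus {a b i k : M} (hik : ∃ d, i = k + (d + 1) ∧ (d + 1) ∣ b ∨
    k = i + (d + 1) ∧ (d + 1) ∣ b) (h : ((i + 1) * b + 1) ∣ a * ((k + 1) * b + 1)) :
    ((i + 1) * b + 1) ∣ a := by
  -- Write `p` for the modulus of `i`. Cross-multiplying the two moduli by `k + 1` and `i + 1`
  -- cancels `b` and leaves `a` times the distance `d + 1`, so `p` divides `a (d + 1)`, hence `a b`.
  -- As `a b (i + 1) + a = a p`, it then divides `a`. No primes are needed.
  have hab : ((i + 1) * b + 1) ∣ a * b := by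
    obtain ⟨d, ⟨rfl, c, hc⟩ | ⟨rfl, c, hc⟩⟩ := hik
    · have h1 : ((k + (d + 1) + 1) * b + 1) ∣
          a * (k + 1) * ((k + (d + 1) + 1) * b + 1) + a * (d + 1) := by
        rw [show a * (k + 1) * ((k + (d + 1) + 1) * b + 1) + a * (d + 1) =
          a * ((k + 1) * b + 1) * (k + (d + 1) + 1) by ring]
        exact h.mul_right _
      have h2 := dvd_of_dvd_add (dvd_mul_left _ _) h1
      have h3 := h2.mul_right c
      rwa [mul_assoc, ← hc] at h3
    · have h1 : ((i + 1) * b + 1) ∣ a * ((i + (d + 1) + 1) * b + 1) * (i + 1) + a * (d + 1) := by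
        rw [show a * ((i + (d + 1) + 1) * b + 1) * (i + 1) + a * (d + 1) =
          a * (i + (d + 1) + 1) * ((i + 1) * b + 1) by ring]
        exact dvd_mul_left _ _
      have h2 := dvd_of_dvd_add (h.mul_right _) h1
      have h3 := h2.mul_right c
      rwa [mul_assoc, ← hc] at h3
  refine dvd_of_dvd_add (hab.mul_right (i + 1)) ?_
  rw [show a * b * (i + 1) + a = a * ((i + 1) * b + 1) by ring]
  exact dvd_mul_left _ _

/-- Comprehension: every bounded definable set is coded. -/
theorem exists_code {P : M → Prop} (hP : Dfn₁ P) (m : M) :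
    ∃ a b, ∀ s, Mem s a b m ↔ s ≤ m ∧ P s := by
  -- Distinct indices up to `m` differ by at most `m`, so `b` is divisible by every distance that
  -- occurs; `b > 0` makes each modulus greater than `1`.
  obtain ⟨b, hb0, hb⟩ := exists_common_multiple (m + 1)
  have coprime : ∀ a i k, i ≤ m → k ≤ m → i ≠ k → ((i + 1) * b + 1) ∣ a * ((k + 1) * b + 1) →
      ((i + 1) * b + 1) ∣ a := by
    intro a i k hi hk hik h
    refine dvd_of_dvd_mul_modulus ?_ h
    rcases lt_or_gt_of_ne hik with hlt | hlt
    · obtain ⟨d, rfl⟩ := (ltOf_iff_add_one _ _).1 hlt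
      refine ⟨d, Or.inr ⟨rfl, hb d ((lt_add_one_iff' _ _).2 (le_trans ?_ hk))⟩⟩
      exact (le_self_add (b := 1)).trans le_add_self
    · obtain ⟨d, rfl⟩ := (ltOf_iff_add_one _ _).1 hlt
      refine ⟨d, Or.inl ⟨rfl, hb d ((lt_add_one_iff' _ _).2 (le_trans ?_ hi))⟩⟩
      exact (le_self_add (b := 1)).trans le_add_self
  -- The code `a` is the product of the moduli of those elements of `P` that are below `k` and at
  -- most `m`, built up by induction on `k` from the empty product `1`.
  have key : ∀ k, ∃ a, ∀ i, i ≤ m → (((i + 1) * b + 1) ∣ a ↔ i < k ∧ P i) := by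
    refine dfn_induction ?_ ?_ ?_
    · exact Dfn.ex (Dfn.all (Dfn.imp (Dfn.le (.var _) (.const _)) (Dfn.iff (Dfn.ex (Dfn.eq (.var _)
        (.mul (.add (.mul (.add (.var _) (.const _)) (.const _)) (.const _)) (.var _))))
        (Dfn.and (Dfn.lt (.var _) (.var _)) (Dfn₁.app hP (.var _))))))
    · refine ⟨1, fun i _ => iff_of_false ?_ (fun h => absurd h.1 not_lt_zero)⟩
      rintro ⟨q, hq⟩
      have hq0 : 0 < q := pos_iff_ne_zero.2 (by rintro rfl; simp at hq)
      have h1 : (1 : M) < (i + 1) * b + 1 :=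
        lt_add_of_pos_left _ (mul_pos (lt_of_le_of_lt zero_le (lt_add_one i)) hb0)
      exact absurd hq (h1.trans_le (le_mul_of_one_le_right zero_le (one_le_of_pos hq0))).ne
    · rintro k ⟨a, ha⟩
      by_cases hk : P k ∧ k ≤ m
      · refine ⟨a * ((k + 1) * b + 1), fun i hi => ?_⟩
        by_cases hik : i = k
        · subst hik
          exact iff_of_true (dvd_mul_left _ _) ⟨lt_add_one _, hk.1⟩
        · rw [lt_add_one_iff', le_iff_lt_or_eq, or_iff_left hik, ← ha i hi]
          exact ⟨coprime a i k hi hk.2 hik, fun h => h.mul_right _⟩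
      · refine ⟨a, fun i hi => ?_⟩
        rw [ha i hi, lt_add_one_iff', le_iff_lt_or_eq]
        refine ⟨fun h => ⟨Or.inl h.1, h.2⟩, ?_⟩
        rintro ⟨h | rfl, h'⟩
        · exact ⟨h, h'⟩
        · exact absurd ⟨h', hi⟩ hk
  obtain ⟨a, ha⟩ := key (m + 1)
  refine ⟨a, b, fun s => ?_⟩
  rw [mem_iff]
  refine and_congr_right fun hs => ?_
  rw [ha s hs, and_iff_right]
  exact (lt_add_one_iff' _ _).2 hs

/-- Comprehension for bounded definable binary relations. -/
theorem exists_pair_code {R : M → M → Prop} (hR : Dfn₂ R) (B : M)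
    (hB : ∀ s t, R s t → s ≤ B ∧ t ≤ B) :
    ∃ a b m, ∀ s t, PairMem s t a b m ↔ R s t := by
  obtain ⟨a, b, h⟩ := exists_code (P := fun z => ∃ s t, z = pair s t ∧ R s t)
    (Dfn.ex (Dfn.ex (Dfn.and (Dfn.eq_pair (.var _) (.var _) (.var _))
      (Dfn₂.app hR (.var _) (.var _))))) (pair B B)
  refine ⟨a, b, pair B B, fun s t => ?_⟩
  simp only [PairMem, isPair_iff, exists_eq_left, h]
  constructor
  · rintro ⟨-, s', t', hst, hR⟩
    obtain ⟨rfl, rfl⟩ := pair_inj.1 hst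
    exact hR
  · exact fun hst => ⟨pair_le_pair (hB s t hst).1 (hB s t hst).2, s, t, rfl, hst⟩

end Coding

/-! ### The canonical embedding into an interpreted model -/

section Embedding

variable {M N : Type w} [LangT.Structure M] [LangT.Structure N] [N ⊨ PAT] {e : N → M}

theorem dfn_add_one (he : Solidity.IsInterpretation LangT LangT e) :
    Dfn₂ (fun a c => ∃ n, a = e n ∧ c = e (n + 1)) :=
  (dfn_fun₁ he Func.succ).congr fun v => by
    change (∃ n, _ ∧ v 1 = e (succOf n)) ↔ _
    simp only [succOf_eq]

theorem dfn_add (he : Solidity.IsInterpretation LangT LangT e) :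
    Dfn₃ (fun a b c => ∃ n k, a = e n ∧ b = e k ∧ c = e (n + k)) :=
  dfn_fun₂ he Func.add

theorem dfn_mul (he : Solidity.IsInterpretation LangT LangT e) :
    Dfn₃ (fun a b c => ∃ n k, a = e n ∧ b = e k ∧ c = e (n * k)) :=
  dfn_fun₂ he Func.mul

variable [M ⊨ PAT]

/-- The set coded by `a, b, m` is a piece of the graph of the canonical embedding. -/
def IsPartialEmbedding (e : N → M) (a b m : M) : Prop :=
  ∀ u y, PairMem u y a b m → (u = 0 ∧ y = e 0) ∨
    ∃ u' y', u = u' + 1 ∧ PairMem u' y' a b m ∧ ∃ n, y' = e n ∧ y = e (n + 1)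

/-- The graph of the canonical embedding. -/
def EmbeddingGraph (e : N → M) (u y : M) : Prop :=
  ∃ a b m, IsPartialEmbedding e a b m ∧ PairMem u y a b m

theorem dfn_embeddingGraph (he : Solidity.IsInterpretation LangT LangT e) :
    Dfn₂ (EmbeddingGraph e) :=
  Dfn.ex (Dfn.ex (Dfn.ex (Dfn.and
    (Dfn.all (Dfn.all (Dfn.imp (Dfn.pairMem (.var _) (.var _) (.var _) (.var _) (.var _))
      (Dfn.or (Dfn.and (Dfn.eq (.var _) (.const _)) (Dfn.eq (.var _) (.const _)))
        (Dfn.ex (Dfn.ex (Dfn.and (Dfn.eq (.var _) (.add (.var _) (.const _)))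
          (Dfn.and (Dfn.pairMem (.var _) (.var _) (.var _) (.var _) (.var _))
            ((dfn_add_one he).app (.var _) (.var _))))))))))
    (Dfn.pairMem (.var _) (.var _) (.var _) (.var _) (.var _)))))

theorem embeddingGraph_zero_iff (y : M) : EmbeddingGraph e 0 y ↔ y = e 0 := by
  constructor
  · rintro ⟨a, b, m, hC, h⟩
    rcases hC 0 y h with h | ⟨u', y', h, -⟩
    · exact h.2
    · exact absurd h.symm (add_one_ne_zero' _)
  · rintro rfl
    obtain ⟨a, b, m, h⟩ := exists_pair_code (R := fun s t : M => s = 0 ∧ t = e 0)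
      (Dfn.and (Dfn.eq (.var _) (.const _)) (Dfn.eq (.var _) (.const _))) (e 0)
      (by rintro s t ⟨rfl, rfl⟩; exact ⟨zero_le, le_rfl⟩)
    refine ⟨a, b, m, fun u y hu => Or.inl ((h u y).1 hu), (h _ _).2 ⟨rfl, rfl⟩⟩

/-- Uniqueness: a piece containing `(u + 1, y)` also contains a predecessor pair `(u, y')`, and `y'`
is known. Existence: a piece reaching `u` is enlarged by one pair. -/
theorem embeddingGraph_add_one_iff (he : Function.Injective e) {u : M} {n : N}
    (h : ∀ y, EmbeddingGraph e u y ↔ y = e n) (y : M) :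
    EmbeddingGraph e (u + 1) y ↔ y = e (n + 1) := by
  constructor
  · rintro ⟨a, b, m, hC, h'⟩
    rcases hC _ y h' with h'' | ⟨u', y', hu, hy', k, rfl, rfl⟩
    · exact absurd h''.1 (add_one_ne_zero' _)
    · obtain rfl := add_right_cancel hu
      rw [he ((h _).1 ⟨a, b, m, hC, hy'⟩)]
  · rintro rfl
    obtain ⟨a, b, m, hC, h'⟩ := (h _).2 rfl
    obtain ⟨a', b', m', h''⟩ := exists_pair_code
      (R := fun s t : M => PairMem s t a b m ∨ s = u + 1 ∧ t = e (n + 1))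
      (Dfn.or (Dfn.pairMem (.var _) (.var _) (.const _) (.const _) (.const _))
        (Dfn.and (Dfn.eq (.var _) (.const _)) (Dfn.eq (.var _) (.const _))))
      (m + (u + 1 + e (n + 1)))
      (by
        rintro s t (h | ⟨rfl, rfl⟩)
        · exact ⟨h.left_le.trans le_self_add, h.right_le.trans le_self_add⟩
        · exact ⟨le_self_add.trans le_add_self, le_add_self.trans le_add_self⟩)
    refine ⟨a', b', m', fun s t hst => ?_, (h'' _ _).2 (Or.inr ⟨rfl, rfl⟩)⟩
    rcases (h'' s t).1 hst with hst | ⟨rfl, rfl⟩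
    · rcases hC s t hst with hst | ⟨u', y', hu, hy', hn⟩
      · exact Or.inl hst
      · exact Or.inr ⟨u', y', hu, (h'' _ _).2 (Or.inl hy'), hn⟩
    · exact Or.inr ⟨u, e n, rfl, (h'' _ _).2 (Or.inl h'), n, rfl, rfl⟩

/-- A model of `PA(T)` has a definable map, commuting with `0` and `S`, into every model of `PA(T)`
that it interprets. -/
theorem exists_canonical_map (he : Solidity.IsInterpretation LangT LangT e) :
    ∃ j : M → N, Dfn₂ (fun a c => c = e (j a)) ∧ j 0 = 0 ∧ ∀ a, j (a + 1) = j a + 1 := by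
  -- The value is sought as an element `c` of `M` in the range of `e`, so that the induction
  -- predicate is definable in `M`. Existence and uniqueness are carried together.
  have key : ∀ u : M, ∃ c, (∃ n, e n = c) ∧ ∀ y, EmbeddingGraph e u y ↔ y = c := by
    refine dfn_induction ?_ ?_ ?_
    · exact Dfn.ex (Dfn.and ((dfn_range he).app (.var _)) (Dfn.all (Dfn.iff
        ((dfn_embeddingGraph he).app (.var _) (.var _)) (Dfn.eq (.var _) (.var _)))))
    · exact ⟨e 0, ⟨0, rfl⟩, embeddingGraph_zero_iff⟩
    · rintro u ⟨_, ⟨n, rfl⟩, h⟩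
      exact ⟨e (n + 1), ⟨n + 1, rfl⟩, embeddingGraph_add_one_iff he.injective h⟩
  have key' : ∀ u : M, ∃ n, ∀ y, EmbeddingGraph e u y ↔ y = e n := fun u => by
    obtain ⟨_, ⟨n, rfl⟩, h⟩ := key u
    exact ⟨n, h⟩
  choose j hj using key'
  refine ⟨j, (dfn_embeddingGraph he).congr fun v => hj _ _, ?_, fun a => ?_⟩
  · exact he.injective ((embeddingGraph_zero_iff _).1 ((hj 0 _).2 rfl))
  · exact he.injective ((embeddingGraph_add_one_iff he.injective (hj a) _).1 ((hj (a + 1) _).2 rfl))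

variable {j : M → N}

theorem canonical_add (he : Solidity.IsInterpretation LangT LangT e)
    (hj : Dfn₂ (fun a c => c = e (j a))) (h0 : j 0 = 0) (hs : ∀ a, j (a + 1) = j a + 1) (a b : M) :
    j (a + b) = j a + j b := by
  refine dfn_induction (P := fun b => j (a + b) = j a + j b) ?_ ?_ ?_ b
  -- An equation in `N` is not yet a predicate of `M`: it is restated for the images under `e`,
  -- through the definable graph of the addition of `N`.
  · refine Dfn.congr (P := fun v => ∃ p, p = e (j (v 0)) ∧ ∃ q, q = e (j (a + v 0)) ∧
      ∃ n k, e (j a) = e n ∧ p = e k ∧ q = e (n + k)) ?_ fun v => ?_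
    · exact Dfn.ex (Dfn.and (Dfn₂.app hj (.var _) (.var _)) (Dfn.ex (Dfn.and
        (Dfn₂.app hj (.add (.const _) (.var _)) (.var _))
        (Dfn₃.app (dfn_add he) (.const _) (.var _) (.var _)))))
    · simp [he.injective.eq_iff]
  · simp [h0]
  · intro b hb
    rw [← add_assoc, hs, hb, hs, add_assoc]

theorem canonical_mul (he : Solidity.IsInterpretation LangT LangT e)
    (hj : Dfn₂ (fun a c => c = e (j a))) (h0 : j 0 = 0) (hs : ∀ a, j (a + 1) = j a + 1) (a b : M) :
    j (a * b) = j a * j b := by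
  refine dfn_induction (P := fun b => j (a * b) = j a * j b) ?_ ?_ ?_ b
  · refine Dfn.congr (P := fun v => ∃ p, p = e (j (v 0)) ∧ ∃ q, q = e (j (a * v 0)) ∧
      ∃ n k, e (j a) = e n ∧ p = e k ∧ q = e (n * k)) ?_ fun v => ?_
    · exact Dfn.ex (Dfn.and (Dfn₂.app hj (.var _) (.var _)) (Dfn.ex (Dfn.and
        (Dfn₂.app hj (.mul (.const _) (.var _)) (.var _))
        (Dfn₃.app (dfn_mul he) (.const _) (.var _) (.var _)))))
    · simp [he.injective.eq_iff]
  · simp [h0]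
  · intro b hb
    rw [mul_add, mul_one, canonical_add he hj h0 hs, hb, hs, mul_add, mul_one]

theorem canonical_strictMono (he : Solidity.IsInterpretation LangT LangT e)
    (hj : Dfn₂ (fun a c => c = e (j a))) (h0 : j 0 = 0) (hs : ∀ a, j (a + 1) = j a + 1) :
    StrictMono j := fun a b hab => by
  obtain ⟨c, rfl⟩ := (ltOf_iff_add_one _ _).1 hab
  rw [canonical_add he hj h0 hs, hs]
  exact (ltOf_iff_add_one _ _).2 ⟨j c, rfl⟩

end Embedding

/-! ### Surjectivity of the canonical map, from the given isomorphism. -/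

section Bijectivity

variable {M N M' : Type w} [LangT.Structure M] [LangT.Structure N] [LangT.Structure M']
  [M ⊨ PAT] [N ⊨ PAT] [M' ⊨ PAT] {e : N → M} {e' : M' → N}

/-- Once `k ∘ j = i`, any `n` has a preimage: choose `a` with `i a = k n`; then `k (j a) = k n`, and
`k` is injective. Of `i`, only surjectivity, definability and the preservation of `0` and `S`
matter. -/
theorem canonical_bijective (he : Solidity.IsInterpretation LangT LangT e)
    (he' : Solidity.IsInterpretation LangT LangT e') {i : M ≃[LangT] M'}
    (hi : Dfn₂ (fun a c => c = e (e' (i a)))) {j : M → N}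
    (hj : Dfn₂ (fun a c => c = e (j a))) (h0 : j 0 = 0) (hs : ∀ a, j (a + 1) = j a + 1) :
    Function.Bijective j := by
  obtain ⟨k, hk, hk0, hks⟩ := exists_canonical_map he'
  have hki : ∀ a, k (j a) = i a := by
    -- The graph of `k` is definable in `N`; induction in `M` needs its translation.
    obtain ⟨Q, hQ, hQ'⟩ := exists_translation₂ he hk
    refine dfn_induction ?_ ?_ ?_
    · refine Dfn.congr (P := fun v => ∃ p, p = e (j (v 0)) ∧ ∃ q, q = e (e' (i (v 0))) ∧ Q p q)
        ?_ fun v => ?_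
      · exact Dfn.ex (Dfn.and (Dfn₂.app hj (.var _) (.var _)) (Dfn.ex (Dfn.and
          (Dfn₂.app hi (.var _) (.var _)) (Dfn₂.app hQ (.var _) (.var _)))))
      · simp [hQ', he'.injective.eq_iff, eq_comm]
    · rw [h0, hk0]
      have := i.map_fun (Func.zero : LangT.Functions 0) ![]
      rw [Subsingleton.elim (i ∘ ![]) ![] ] at this
      exact this.symm
    · intro a ha
      rw [hs, hks, ha, ← succOf_eq, ← succOf_eq]
      have := i.map_fun (Func.succ : LangT.Functions 1) ![a]
      rw [show i ∘ ![a] = ![i a] by ext t; fin_cases t; rfl] at this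
      exact this.symm
  refine ⟨(canonical_strictMono he hj h0 hs).injective, fun n => ?_⟩
  obtain ⟨a, ha⟩ := i.surjective (k n)
  refine ⟨a, (canonical_strictMono he' hk hk0 hks).injective ?_⟩
  rw [hki, ha]

end Bijectivity

/-! ### The arithmetized syntax, semantically -/

/-- The symbols of arithmetic are interpreted in `M` by the operations and the order of `M`. -/
class IsArith (M : Type w) [LangT.Structure M] [CommSemiring M] [LT M] : Prop where
  zeroOf_eq : zeroOf M = 0
  succOf_eq (a : M) : succOf a = a + 1
  addOf_eq (a b : M) : addOf a b = a + b
  mulOf_eq (a b : M) : mulOf a b = a * b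
  ltOf_iff (a b : M) : ltOf a b ↔ a < b

instance {M : Type w} [LangT.Structure M] [M ⊨ PAT] : IsArith M where
  zeroOf_eq := zeroOf_eq
  succOf_eq := succOf_eq
  addOf_eq := addOf_eq
  mulOf_eq := mulOf_eq
  ltOf_iff := ltOf_eq

section Arithmetization

variable {M : Type w} [CommSemiring M] [LT M]

/-- `z` is the expression with outermost symbol `k` and constituent `s`. -/
def Unary (k : ℕ) (z s : M) : Prop := IsPair z k s

/-- `z` is the expression with outermost symbol `k` and constituents `s`, `t`. -/
def Binary (k : ℕ) (z s t : M) : Prop := ∃ p, IsPair p s t ∧ Unary k z p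

/-- `s` is a term. -/
def IsTerm (s : M) : Prop :=
  ∃ a b m, Mem s a b m ∧ ∀ c, Mem c a b m →
    (((∃ i, Unary 1 c i) ∨ Unary 2 c 0) ∨ ∃ p, Unary 3 c p ∧ Mem p a b m) ∨
      ∃ p q, ((Binary 4 c p q ∨ Binary 5 c p q) ∧ Mem p a b m) ∧ Mem q a b m

/-- The variable `i` occurs in the term `s`. -/
def OccursIn (i s : M) : Prop :=
  ∃ a b m, Mem s a b m ∧ ∀ c, Mem c a b m →
    (Unary 1 c i ∨ ∃ p, Unary 3 c p ∧ Mem p a b m) ∨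
      ∃ p q, (Binary 4 c p q ∨ Binary 5 c p q) ∧ (Mem p a b m ∨ Mem q a b m)

/-- `s` is a closed term. -/
def IsClosedTerm (s : M) : Prop := IsTerm s ∧ ∀ i, ¬ OccursIn i s

/-- The set coded by `a, b, m` witnesses that its elements are formulas. -/
def IsFormulaCert (a b m : M) : Prop :=
  ∀ c, Mem c a b m →
    (((∃ p q, ((Binary 6 c p q ∨ Binary 7 c p q) ∧ IsTerm p) ∧ IsTerm q) ∨
      ∃ p, Unary 8 c p ∧ Mem p a b m) ∨
      ∃ p q, (Binary 9 c p q ∧ Mem p a b m) ∧ Mem q a b m) ∨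
      ∃ i p, Binary 10 c i p ∧ Mem p a b m

/-- `s` is a formula. -/
def IsFormula (s : M) : Prop := ∃ a b m, Mem s a b m ∧ IsFormulaCert a b m

/-- The set coded by `a, b, m` witnesses that `i` is free in its elements. -/
def FreeInCert (i a b m : M) : Prop :=
  ∀ c, Mem c a b m →
    (((∃ p q, (Binary 6 c p q ∨ Binary 7 c p q) ∧ (OccursIn i p ∨ OccursIn i q)) ∨
      ∃ p, Unary 8 c p ∧ Mem p a b m) ∨
      ∃ p q, Binary 9 c p q ∧ (Mem p a b m ∨ Mem q a b m)) ∨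
      ∃ k p, (Binary 10 c k p ∧ ¬ k = i) ∧ Mem p a b m

/-- The variable `i` is free in the formula `s`. -/
def FreeIn (i s : M) : Prop := ∃ a b m, Mem s a b m ∧ FreeInCert i a b m

/-- `s` is a sentence. -/
def IsSentence (s : M) : Prop := IsFormula s ∧ ∀ i, ¬ FreeIn i s

/-- `y` is the value of the closed term `s`. -/
def HasValue (s y : M) : Prop :=
  ∃ a b m, PairMem s y a b m ∧ ∀ c d, PairMem c d a b m →
    ((Unary 2 c 0 ∧ d = 0) ∨ ∃ p q, (Unary 3 c p ∧ d = q + 1) ∧ PairMem p q a b m) ∨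
      ∃ p q p' q', (((Binary 4 c p p' ∧ d = q + q') ∨ (Binary 5 c p p' ∧ d = q * q')) ∧
        PairMem p q a b m) ∧ PairMem p' q' a b m

/-- `t` is the numeral for `n`. -/
def IsNumeral (n t : M) : Prop :=
  ∃ a b m, PairMem n t a b m ∧ ∀ c d, PairMem c d a b m →
    (c = 0 ∧ Unary 2 d 0) ∨ ∃ p q, (c = p + 1 ∧ Unary 3 d q) ∧ PairMem p q a b m

/-- The term `s'` results from substituting `t` for `i` in the term `s`. -/
def IsTermSubst (i t s s' : M) : Prop :=
  ∃ a b m, PairMem s s' a b m ∧ ∀ c d, PairMem c d a b m →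
    ((((Unary 1 c i ∧ d = t) ∨ ∃ p, (Unary 1 c p ∧ ¬ p = i) ∧ d = c) ∨
      (Unary 2 c 0 ∧ Unary 2 d 0)) ∨
      ∃ p q, (Unary 3 c p ∧ Unary 3 d q) ∧ PairMem p q a b m) ∨
      ∃ p q p' q', (((Binary 4 c p p' ∧ Binary 4 d q q') ∨ (Binary 5 c p p' ∧ Binary 5 d q q')) ∧
        PairMem p q a b m) ∧ PairMem p' q' a b m

/-- The set coded by `a, b, m` witnesses that its elements are pairs of formulas the second of which
results from substituting `t` for `i` in the first. -/
def IsSubstCert (i t a b m : M) : Prop :=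
  ∀ c d, PairMem c d a b m →
    ((((∃ p q p' q', (((Binary 6 c p p' ∧ Binary 6 d q q') ∨ (Binary 7 c p p' ∧ Binary 7 d q q')) ∧
        IsTermSubst i t p q) ∧ IsTermSubst i t p' q') ∨
      ∃ p q, (Unary 8 c p ∧ Unary 8 d q) ∧ PairMem p q a b m) ∨
      ∃ p q p' q', ((Binary 9 c p p' ∧ Binary 9 d q q') ∧ PairMem p q a b m) ∧
        PairMem p' q' a b m) ∨
      ∃ p, Binary 10 c i p ∧ d = c) ∨
      ∃ p q k, ((Binary 10 c k p ∧ Binary 10 d k q) ∧ ¬ k = i) ∧ PairMem p q a b m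

/-- The formula `s'` results from substituting `t` for `i` in the formula `s`. -/
def IsSubst (i t s s' : M) : Prop := ∃ a b m, PairMem s s' a b m ∧ IsSubstCert i t a b m

/-- Tarski's clauses for a predicate `T`. -/
structure IsTruth (T : M → Prop) : Prop where
  isSentence {s : M} : T s → IsSentence s
  eq_iff {s t r : M} : IsClosedTerm s → IsClosedTerm t → Binary 6 r s t →
    (T r ↔ ∃ y, HasValue s y ∧ HasValue t y)
  lt_iff {s t r : M} : IsClosedTerm s → IsClosedTerm t → Binary 7 r s t →
    (T r ↔ ∃ y y', (HasValue s y ∧ HasValue t y') ∧ y < y')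
  neg_iff {s r : M} : IsSentence s → Unary 8 r s → (T r ↔ ¬ T s)
  conj_iff {s t r : M} : IsSentence s → IsSentence t → Binary 9 r s t → (T r ↔ T s ∧ T t)
  all_iff {i s r : M} : IsSentence r → Binary 10 r i s →
    (T r ↔ ∀ n t s', IsNumeral n t ∧ IsSubst i t s s' → T s')

end Arithmetization

/-! ### Evaluation of the formulas of the arithmetized syntax. -/

section Realize

variable {M : Type w} [LangT.Structure M] [CommSemiring M] [LT M] [IsArith M] (v : ℕ → M)

theorem realize_num (k : ℕ) : (num k).realize v = (k : M) := by
  induction k with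
  | zero => simp [num, IsArith.zeroOf_eq]
  | succ k ih => simp [num, IsArith.succOf_eq, ih]

@[simp]
theorem realize_isPair (z s t : Tm) :
    (isPair z s t).Realize v ↔ IsPair (z.realize v) (s.realize v) (t.realize v) := by
  simp [isPair, IsPair, IsArith.addOf_eq, IsArith.mulOf_eq, IsArith.succOf_eq]

@[simp]
theorem realize_mem (s a b m : Tm) :
    (mem s a b m).Realize v ↔
      Mem (s.realize v) (a.realize v) (b.realize v) (m.realize v) := by
  simp [mem, le, Mem, IsArith.mulOf_eq, IsArith.succOf_eq, IsArith.ltOf_iff]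

@[simp]
theorem realize_pairMem (s t a b m : Tm) :
    (pairMem s t a b m).Realize v ↔
      PairMem (s.realize v) (t.realize v) (a.realize v) (b.realize v) (m.realize v) := by
  simp [pairMem, PairMem]

@[simp]
theorem realize_unary (k : ℕ) (z s : Tm) :
    (unary k z s).Realize v ↔ Unary k (z.realize v) (s.realize v) := by
  simp [unary, Unary, realize_num]

@[simp]
theorem realize_binary (k : ℕ) (z s t : Tm) :
    (binary k z s t).Realize v ↔ Binary k (z.realize v) (s.realize v) (t.realize v) := by
  simp [binary, Binary]

@[simp]
theorem realize_inSet (s : Tm) :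
    (inSet s).Realize v ↔ Mem (s.realize v) (v 20) (v 21) (v 22) := by
  simp [inSet]

@[simp]
theorem realize_pairInSet (s t : Tm) :
    (pairInSet s t).Realize v ↔ PairMem (s.realize v) (t.realize v) (v 20) (v 21) (v 22) := by
  simp [pairInSet]

@[simp]
theorem realize_isTerm (s : Tm) : (isTerm s).Realize v ↔ IsTerm (s.realize v) := by
  simp [isTerm, certified, isVar, isZero, isSucc, isAdd, isMul, IsTerm, IsArith.zeroOf_eq]

@[simp]
theorem realize_occursIn (i s : Tm) :
    (occursIn i s).Realize v ↔ OccursIn (i.realize v) (s.realize v) := by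
  simp [occursIn, certified, isVar, isSucc, isAdd, isMul, OccursIn]

@[simp]
theorem realize_isClosedTerm (s : Tm) :
    (isClosedTerm s).Realize v ↔ IsClosedTerm (s.realize v) := by
  simp [isClosedTerm, IsClosedTerm]

@[simp]
theorem realize_isFormula (s : Tm) : (isFormula s).Realize v ↔ IsFormula (s.realize v) := by
  simp [isFormula, certified, isEq, isLt, isNeg, isConj, isAll, IsFormula, IsFormulaCert]

@[simp]
theorem realize_freeIn (i s : Tm) :
    (freeIn i s).Realize v ↔ FreeIn (i.realize v) (s.realize v) := by
  simp [freeIn, certified, isEq, isLt, isNeg, isConj, isAll, FreeIn, FreeInCert]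

@[simp]
theorem realize_isSentence (s : Tm) :
    (isSentence s).Realize v ↔ IsSentence (s.realize v) := by
  simp [isSentence, IsSentence]

@[simp]
theorem realize_hasValue (s y : Tm) :
    (hasValue s y).Realize v ↔ HasValue (s.realize v) (y.realize v) := by
  simp [hasValue, pairCertified, isZero, isSucc, isAdd, isMul, HasValue, IsArith.zeroOf_eq,
    IsArith.succOf_eq, IsArith.addOf_eq, IsArith.mulOf_eq]

@[simp]
theorem realize_isNumeral (n t : Tm) :
    (isNumeral n t).Realize v ↔ IsNumeral (n.realize v) (t.realize v) := by
  simp [isNumeral, pairCertified, isZero, isSucc, IsNumeral, IsArith.zeroOf_eq, IsArith.succOf_eq]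

@[simp]
theorem realize_isTermSubst (i t s s' : Tm) :
    (isTermSubst i t s s').Realize v ↔
      IsTermSubst (i.realize v) (t.realize v) (s.realize v) (s'.realize v) := by
  simp [isTermSubst, pairCertified, isVar, isZero, isSucc, isAdd, isMul, IsTermSubst,
    IsArith.zeroOf_eq]

@[simp]
theorem realize_isSubst (i t s s' : Tm) :
    (isSubst i t s s').Realize v ↔
      IsSubst (i.realize v) (t.realize v) (s.realize v) (s'.realize v) := by
  simp [isSubst, pairCertified, isEq, isLt, isNeg, isConj, isAll, IsSubst, IsSubstCert]

/-- Only agreement of the arithmetical symbols with a given semiring and order is assumed, so the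
lemma also applies when `T` is reinterpreted over the same arithmetic. -/
theorem isTruth_trOf (h : M ⊨ tarski) : IsTruth (trOf (M := M)) := by
  rw [tarski, realize_toSentence] at h
  simp [onlySentences, truthEq, truthLt, truthNeg, truthConj, truthAll, isEq, isLt, isNeg, isConj,
    isAll, IsArith.ltOf_iff] at h
  obtain ⟨⟨⟨⟨⟨h₁, h₂⟩, h₃⟩, h₄⟩, h₅⟩, h₆⟩ := h
  exact
    { isSentence := h₁ _
      eq_iff := h₂ _ _ _
      lt_iff := fun hs ht hr => (h₃ _ _ _ hs ht hr).trans
        (exists_congr fun _ => exists_congr fun _ => Iff.rfl)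
      neg_iff := h₄ _ _
      conj_iff := h₅ _ _ _
      all_iff := fun hr h => (h₆ _ _ _ hr h).trans (by simp only [and_imp]) }

end Realize

/-! ### Uniqueness of truth predicates -/

section Uniqueness

variable {M : Type w} [LangT.Structure M] [M ⊨ PAT]

theorem unary_iff {k : ℕ} {z s : M} : Unary k z s ↔ z = pair (k : M) s := isPair_iff

theorem binary_iff {k : ℕ} {z s t : M} : Binary k z s t ↔ z = pair (k : M) (pair s t) := by
  simp only [Binary, unary_iff, isPair_iff, exists_eq_left]

theorem Dfn.unary {ι : Type} (k : ℕ) {f g : (ι → M) → M} (hf : Tdf f) (hg : Tdf g) :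
    Dfn (fun v => Unary k (f v) (g v)) :=
  Dfn.isPair hf (.const _) hg

theorem Dfn.binary {ι : Type} (k : ℕ) {f g h : (ι → M) → M} (hf : Tdf f) (hg : Tdf g)
    (hh : Tdf h) : Dfn (fun v => Binary k (f v) (g v) (h v)) :=
  Dfn.ex (Dfn.and (Dfn.isPair (.var _) hg.weaken hh.weaken) (Dfn.unary k hf.weaken (.var _)))

/-- Since tags are positive, an expression has a strictly larger code than its constituent; this
will make the code of a formula a bound for its rank. -/
theorem Unary.lt {k : ℕ} (hk : 0 < k) {z s : M} (h : Unary k z s) : s < z := by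
  rw [unary_iff] at h
  subst h
  exact lt_of_lt_of_le (lt_add_of_pos_left _ (Nat.cast_pos.2 hk)) (add_le_pair _ _)

theorem Binary.left_lt {k : ℕ} (hk : 0 < k) {z s t : M} (h : Binary k z s t) : s < z := by
  obtain ⟨p, hp, h⟩ := h
  exact (le_self_add.trans hp.add_le).trans_lt (h.lt hk)

theorem Binary.right_lt {k : ℕ} (hk : 0 < k) {z s t : M} (h : Binary k z s t) : t < z := by
  obtain ⟨p, hp, h⟩ := h
  exact (le_add_self.trans hp.add_le).trans_lt (h.lt hk)

theorem Unary.inj {k : ℕ} {z s s' : M} (h : Unary k z s) (h' : Unary k z s') : s = s' :=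
  (pair_inj.1 ((unary_iff.1 h).symm.trans (unary_iff.1 h'))).2

theorem Binary.inj {k : ℕ} {z s t s' t' : M} (h : Binary k z s t) (h' : Binary k z s' t') :
    s = s' ∧ t = t' :=
  pair_inj.1 (pair_inj.1 ((binary_iff.1 h).symm.trans (binary_iff.1 h'))).2

theorem Unary.tag_eq {k l : ℕ} {z s s' : M} (h : Unary k z s) (h' : Unary l z s') : k = l :=
  Nat.cast_injective (pair_inj.1 ((unary_iff.1 h).symm.trans (unary_iff.1 h'))).1

theorem Binary.exists_unary {k : ℕ} {z s t : M} (h : Binary k z s t) : ∃ p, Unary k z p :=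
  let ⟨p, _, h⟩ := h
  ⟨p, h⟩

theorem Mem.le {s a b m : M} (h : Mem s a b m) : s ≤ m := (mem_iff.1 h).1

theorem exists_code_of_bounded {P : M → Prop} (hP : Dfn₁ P) (B : M) (hB : ∀ s, P s → s ≤ B) :
    ∃ a b m, ∀ s, Mem s a b m ↔ P s := by
  obtain ⟨a, b, h⟩ := exists_code hP B
  exact ⟨a, b, B, fun s => (h s).trans (and_iff_right_of_imp (hB s))⟩

theorem exists_insert_code (a b m r : M) : ∃ a' b' m', ∀ s, Mem s a' b' m' ↔ Mem s a b m ∨ s = r :=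
  exists_code_of_bounded
    (Dfn.or (Dfn.mem (.var _) (.const _) (.const _) (.const _)) (Dfn.eq (.var _) (.const _)))
    (m + r) (by
      rintro s (h | rfl)
      · exact h.le.trans le_self_add
      · exact le_add_self)

theorem FreeIn.of_atomic {i r p q : M} (h : Binary 6 r p q ∨ Binary 7 r p q)
    (hi : OccursIn i p ∨ OccursIn i q) : FreeIn i r := by
  obtain ⟨a, b, m, h'⟩ := exists_code_of_bounded (P := fun s => s = r)
    (Dfn.eq (.var _) (.const _)) r (fun s hs => hs.le)
  refine ⟨a, b, m, (h' r).2 rfl, fun c hc => ?_⟩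
  obtain rfl := (h' c).1 hc
  exact Or.inl (Or.inl (Or.inl ⟨p, q, h, hi⟩))

/-- A set witnessing that `i` is free can be extended by formulas with constituents in it. -/
theorem FreeIn.extend {i p r : M} (hp : FreeIn i p)
    (h : ∀ a b m : M, Mem p a b m →
      ((∃ p, Unary 8 r p ∧ Mem p a b m) ∨
        ∃ p q, Binary 9 r p q ∧ (Mem p a b m ∨ Mem q a b m))) : FreeIn i r := by
  obtain ⟨a, b, m, hm, hc⟩ := hp
  obtain ⟨a', b', m', h'⟩ := exists_insert_code a b m r
  refine ⟨a', b', m', (h' r).2 (Or.inr rfl), fun c hc' => ?_⟩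
  rcases (h' c).1 hc' with hc' | rfl
  · simp only [h']
    rcases hc c hc' with ((h | ⟨p, h, h1⟩) | ⟨p, q, h, h1⟩) | ⟨k, p, h, h1⟩
    · exact Or.inl (Or.inl (Or.inl h))
    · exact Or.inl (Or.inl (Or.inr ⟨p, h, Or.inl h1⟩))
    · exact Or.inl (Or.inr ⟨p, q, h, h1.imp Or.inl Or.inl⟩)
    · exact Or.inr ⟨k, p, h, Or.inl h1⟩
  · rcases h a' b' m' ((h' p).2 (Or.inl hm)) with h | h
    · exact Or.inl (Or.inl (Or.inr h))
    · exact Or.inl (Or.inr h)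

theorem FreeIn.neg {i p r : M} (h : Unary 8 r p) (hp : FreeIn i p) : FreeIn i r :=
  hp.extend fun _ _ _ hm => Or.inl ⟨p, h, hm⟩

theorem FreeIn.conj_left {i p q r : M} (h : Binary 9 r p q) (hp : FreeIn i p) : FreeIn i r :=
  hp.extend fun _ _ _ hm => Or.inr ⟨p, q, h, Or.inl hm⟩

theorem FreeIn.conj_right {i p q r : M} (h : Binary 9 r p q) (hq : FreeIn i q) : FreeIn i r :=
  hq.extend fun _ _ _ hm => Or.inr ⟨p, q, h, Or.inr hm⟩

/-- The possible shapes of a sentence. -/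
theorem IsSentence.cases {r : M} (hr : IsSentence r) :
    (∃ p q, (Binary 6 r p q ∨ Binary 7 r p q) ∧ IsClosedTerm p ∧ IsClosedTerm q) ∨
      (∃ p, Unary 8 r p ∧ IsSentence p) ∨
      (∃ p q, Binary 9 r p q ∧ IsSentence p ∧ IsSentence q) ∨
      ∃ i p, Binary 10 r i p := by
  obtain ⟨⟨a, b, m, hm, hc⟩, hf⟩ := hr
  rcases hc r hm with ((⟨p, q, ⟨h, hp⟩, hq⟩ | ⟨p, h, hp⟩) | ⟨p, q, ⟨h, hp⟩, hq⟩) | ⟨i, p, h, -⟩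
  · exact Or.inl ⟨p, q, h, ⟨hp, fun i hi => hf i (.of_atomic h (Or.inl hi))⟩,
      ⟨hq, fun i hi => hf i (.of_atomic h (Or.inr hi))⟩⟩
  · exact Or.inr (Or.inl ⟨p, h, ⟨a, b, m, hp, hc⟩, fun i hi => hf i (.neg h hi)⟩)
  · exact Or.inr (Or.inr (Or.inl ⟨p, q, h, ⟨⟨a, b, m, hp, hc⟩, fun i hi => hf i (.conj_left h hi)⟩,
      ⟨a, b, m, hq, hc⟩, fun i hi => hf i (.conj_right h hi)⟩))
  -- Nothing is claimed about the body `p`, in which `v_i` may be free; Tarski's clause for `∀` only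
  -- asks that `r` itself be a sentence.
  · exact Or.inr (Or.inr (Or.inr ⟨i, p, h⟩))

/-! ### Ranks of formulas and their invariance under substitution. -/

/-- The set coded by `a, b, m` consists of pairs of a formula and a bound for its rank. -/
def RankCert (a b m : M) : Prop :=
  ∀ c d, PairMem c d a b m →
    (∃ p q, Binary 6 c p q ∨ Binary 7 c p q) ∨
      (∃ p q, Unary 8 c p ∧ q < d ∧ PairMem p q a b m) ∨
      (∃ p q p' q', Binary 9 c p p' ∧ (q < d ∧ PairMem p q a b m) ∧
        (q' < d ∧ PairMem p' q' a b m)) ∨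
      ∃ i p q, Binary 10 c i p ∧ q < d ∧ PairMem p q a b m

/-- `d` bounds the rank of the formula `s`. Unlike codes, ranks are invariant under substitution. -/
def RankLE (s d : M) : Prop := ∃ a b m, PairMem s d a b m ∧ RankCert a b m

theorem dfn_rankLE : Dfn₂ (RankLE (M := M)) := by
  have hm : ∀ {ι : Type} {f g h k l : ι}, Dfn (fun v : ι → M =>
      PairMem (v f) (v g) (v h) (v k) (v l)) :=
    Dfn.pairMem (.var _) (.var _) (.var _) (.var _) (.var _)
  have hl : ∀ {ι : Type} {f g : ι}, Dfn (fun v : ι → M => v f < v g) := Dfn.lt (.var _) (.var _)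
  have hu : ∀ {ι : Type} {f g : ι} {k : ℕ}, Dfn (fun v : ι → M => Unary k (v f) (v g)) :=
    Dfn.unary _ (.var _) (.var _)
  have hb : ∀ {ι : Type} {f g h : ι} {k : ℕ}, Dfn (fun v : ι → M => Binary k (v f) (v g) (v h)) :=
    Dfn.binary _ (.var _) (.var _) (.var _)
  exact Dfn.ex (Dfn.ex (Dfn.ex (Dfn.and hm (Dfn.all (Dfn.all (Dfn.imp hm
    (Dfn.or (Dfn.ex (Dfn.ex (Dfn.or hb hb)))
      (Dfn.or (Dfn.ex (Dfn.ex (Dfn.and hu (Dfn.and hl hm))))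
        (Dfn.or (Dfn.ex (Dfn.ex (Dfn.ex (Dfn.ex (Dfn.and hb
            (Dfn.and (Dfn.and hl hm) (Dfn.and hl hm)))))))
          (Dfn.ex (Dfn.ex (Dfn.ex (Dfn.and hb (Dfn.and hl hm))))))))))))))

/-- Constituents have smaller codes, so the diagonal of a set witnessing formulahood is a rank
certificate. This provides every formula, standard or not, with some rank bound. -/
theorem IsFormula.rankLE_self {s : M} (h : IsFormula s) : RankLE s s := by
  obtain ⟨a, b, m, hm, hc⟩ := h
  obtain ⟨a', b', m', h'⟩ := exists_pair_code (R := fun c d => Mem c a b m ∧ d = c)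
    (Dfn.and (Dfn.mem (.var _) (.const _) (.const _) (.const _)) (Dfn.eq (.var _) (.var _))) m
    (by rintro c d ⟨h, rfl⟩; exact ⟨h.le, h.le⟩)
  refine ⟨a', b', m', (h' s s).2 ⟨hm, rfl⟩, fun c d hcd => ?_⟩
  simp only [h']
  obtain ⟨hcd, rfl⟩ := (h' c d).1 hcd
  rcases hc _ hcd with ((⟨p, q, ⟨h, -⟩, -⟩ | ⟨p, h, hp⟩) | ⟨p, q, ⟨h, hp⟩, hq⟩) | ⟨i, p, h, hp⟩
  · exact Or.inl ⟨p, q, h⟩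
  · exact Or.inr (Or.inl ⟨p, p, h, h.lt (by norm_num), hp, rfl⟩)
  · exact Or.inr (Or.inr (Or.inl ⟨p, p, q, q, h, ⟨h.left_lt (by norm_num), hp, rfl⟩,
      h.right_lt (by norm_num), hq, rfl⟩))
  · exact Or.inr (Or.inr (Or.inr ⟨i, p, p, h, h.right_lt (by norm_num), hp, rfl⟩))

/-- Unique readability: the tags of the outermost symbols differ, so only the clause for the actual
shape of `s` can apply, and injectivity of pairing identifies the constituents. -/
theorem RankCert.cases {a b m s d : M} (hc : RankCert a b m) (hm : PairMem s d a b m) :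
    (∀ p, Unary 8 s p → ∃ q < d, PairMem p q a b m) ∧
      (∀ p p', Binary 9 s p p' →
        (∃ q < d, PairMem p q a b m) ∧ ∃ q < d, PairMem p' q a b m) ∧
      ∀ i p, Binary 10 s i p → ∃ q < d, PairMem p q a b m := by
  have tag : ∀ {k l : ℕ} {p q : M}, Unary k s p → Unary l s q → k ≠ l → False :=
    fun h h' hkl => hkl (h.tag_eq h')
  rcases hc s d hm with ⟨p, q, h⟩ | ⟨p, q, h, hq, hpq⟩ | ⟨p, q, p', q', h, ⟨hq, hpq⟩, hq', hpq'⟩ |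
    ⟨i, p, q, h, hq, hpq⟩
  · obtain ⟨t, k, hk, h⟩ : ∃ (t : M) (k : ℕ), k < 8 ∧ Unary k s t := by
      rcases h with h | h
      · exact ⟨_, 6, by norm_num, h.exists_unary.choose_spec⟩
      · exact ⟨_, 7, by norm_num, h.exists_unary.choose_spec⟩
    refine ⟨fun p hp => (tag h hp (by omega)).elim, fun p p' hp => ?_, fun p p' hp => ?_⟩
    · exact (tag h hp.exists_unary.choose_spec (by omega)).elim
    · exact (tag h hp.exists_unary.choose_spec (by omega)).elim
  · refine ⟨fun r hr => ?_, fun p p' hp => ?_, fun p p' hp => ?_⟩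
    · obtain rfl := h.inj hr
      exact ⟨q, hq, hpq⟩
    · exact (tag h hp.exists_unary.choose_spec (by norm_num)).elim
    · exact (tag h hp.exists_unary.choose_spec (by norm_num)).elim
  · refine ⟨fun r hr => ?_, fun r r' hr => ?_, fun r r' hr => ?_⟩
    · exact (tag h.exists_unary.choose_spec hr (by norm_num)).elim
    · obtain ⟨rfl, rfl⟩ := h.inj hr
      exact ⟨⟨q, hq, hpq⟩, q', hq', hpq'⟩
    · exact (tag h.exists_unary.choose_spec hr.exists_unary.choose_spec (by norm_num)).elim
  · refine ⟨fun r hr => ?_, fun r r' hr => ?_, fun r r' hr => ?_⟩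
    · exact (tag h.exists_unary.choose_spec hr (by norm_num)).elim
    · exact (tag h.exists_unary.choose_spec hr.exists_unary.choose_spec (by norm_num)).elim
    · obtain ⟨rfl, rfl⟩ := h.inj hr
      exact ⟨q, hq, hpq⟩

/-- The immediate constituents of a formula have smaller rank. -/
theorem RankLE.cases {s d : M} (h : RankLE s d) :
    (∀ p, Unary 8 s p → ∃ q < d, RankLE p q) ∧
      (∀ p p', Binary 9 s p p' → (∃ q < d, RankLE p q) ∧ ∃ q < d, RankLE p' q) ∧
      ∀ i p, Binary 10 s i p → ∃ q < d, RankLE p q := by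
  obtain ⟨a, b, m, hm, hc⟩ := h
  have le {p : M} : (∃ q < d, PairMem p q a b m) → ∃ q < d, RankLE p q :=
    fun ⟨q, hq, hpq⟩ => ⟨q, hq, a, b, m, hpq, hc⟩
  obtain ⟨h₁, h₂, h₃⟩ := hc.cases hm
  exact ⟨fun p hp => le (h₁ p hp), fun p p' hp => (h₂ p p' hp).imp le le,
    fun i p hp => le (h₃ i p hp)⟩

/-- Substitution alters terms only and keeps the shape of formulas. The new certificate gives each
substituted formula every rank bound that its original has in the old one. -/
theorem RankLE.subst {i t s s' d : M} (hs : IsSubst i t s s') (h : RankLE s d) : RankLE s' d := by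
  obtain ⟨a, b, m, hm, hc⟩ := hs
  obtain ⟨a', b', m', hm', hc'⟩ := h
  obtain ⟨a₁, b₁, m₁, h₁⟩ := exists_pair_code
    (R := fun c d => PairMem c d a' b' m' ∨ ∃ r, PairMem r c a b m ∧ PairMem r d a' b' m')
    (Dfn.or (Dfn.pairMem (.var _) (.var _) (.const _) (.const _) (.const _))
      (Dfn.ex (Dfn.and (Dfn.pairMem (.var _) (.var _) (.const _) (.const _) (.const _))
        (Dfn.pairMem (.var _) (.var _) (.const _) (.const _) (.const _))))) (m + m')
    (by
      rintro c d (h | ⟨r, h, h'⟩)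
      · exact ⟨h.left_le.trans le_add_self, h.right_le.trans le_add_self⟩
      · exact ⟨h.right_le.trans le_self_add, h'.right_le.trans le_add_self⟩)
  -- The old pairs are retained because substitution stops at a quantifier binding `v_i`: there the
  -- formula is unchanged, and the substitution certificate need not say anything about its
  -- constituents.
  have old : ∀ c d, PairMem c d a' b' m' →
      (∃ p q, Binary 6 c p q ∨ Binary 7 c p q) ∨
      (∃ p q, Unary 8 c p ∧ q < d ∧ PairMem p q a₁ b₁ m₁) ∨
      (∃ p q p' q', Binary 9 c p p' ∧ (q < d ∧ PairMem p q a₁ b₁ m₁) ∧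
        (q' < d ∧ PairMem p' q' a₁ b₁ m₁)) ∨
      ∃ i p q, Binary 10 c i p ∧ q < d ∧ PairMem p q a₁ b₁ m₁ := by
    intro c d hcd
    rcases hc' c d hcd with h | ⟨p, q, h, hq, hpq⟩ | ⟨p, q, p', q', h, ⟨hq, hpq⟩, hq', hpq'⟩ |
      ⟨i, p, q, h, hq, hpq⟩
    · exact Or.inl h
    · exact Or.inr (Or.inl ⟨p, q, h, hq, (h₁ _ _).2 (Or.inl hpq)⟩)
    · exact Or.inr (Or.inr (Or.inl ⟨p, q, p', q', h, ⟨hq, (h₁ _ _).2 (Or.inl hpq)⟩, hq',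
        (h₁ _ _).2 (Or.inl hpq')⟩))
    · exact Or.inr (Or.inr (Or.inr ⟨i, p, q, h, hq, (h₁ _ _).2 (Or.inl hpq)⟩))
  refine ⟨a₁, b₁, m₁, (h₁ _ _).2 (Or.inr ⟨s, hm, hm'⟩), fun c d hcd => ?_⟩
  rcases (h₁ c d).1 hcd with hcd | ⟨r, hrc, hrd⟩
  · exact old c d hcd
  obtain ⟨hneg, hconj, hall⟩ := hc'.cases hrd
  rcases hc r c hrc with (((⟨p, q, p', q', ⟨h, -⟩, -⟩ | ⟨p, q, ⟨h, h'⟩, hpq⟩) |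
    ⟨p, q, p', q', ⟨⟨h, h'⟩, hpq⟩, hpq'⟩) | ⟨p, -, rfl⟩) | ⟨p, q, k, ⟨⟨h, h'⟩, -⟩, hpq⟩
  · exact Or.inl ⟨q, q', h.imp And.right And.right⟩
  · obtain ⟨d', hd', hp⟩ := hneg p h
    exact Or.inr (Or.inl ⟨q, d', h', hd', (h₁ _ _).2 (Or.inr ⟨p, hpq, hp⟩)⟩)
  · obtain ⟨⟨d₁, hd₁, hp₁⟩, d₂, hd₂, hp₂⟩ := hconj p p' h
    exact Or.inr (Or.inr (Or.inl ⟨q, d₁, q', d₂, h', ⟨hd₁, (h₁ _ _).2 (Or.inr ⟨p, hpq, hp₁⟩)⟩,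
      hd₂, (h₁ _ _).2 (Or.inr ⟨p', hpq', hp₂⟩)⟩))
  · exact old _ d hrd
  · obtain ⟨d', hd', hp⟩ := hall k p h
    exact Or.inr (Or.inr (Or.inr ⟨k, q, d', h', hd', (h₁ _ _).2 (Or.inr ⟨p, hpq, hp⟩)⟩))

/-- Two definable truth predicates coincide. -/
theorem IsTruth.unique {T T' : M → Prop} (hT : IsTruth T) (hT' : IsTruth T') (dT : Dfn₁ T)
    (dT' : Dfn₁ T') (s : M) : T s ↔ T' s := by
  -- Induction on codes would fail, since an instance of a universal sentence at a large numeral can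
  -- have a larger code than the sentence. The bound `d` works, and quantifying over all `s` makes
  -- the hypothesis available for all instances at once.
  have key : ∀ d s : M, RankLE s d → (T s ↔ T' s) := by
    refine dfn_strong_induction ?_ fun d ih s hs => ?_
    · exact Dfn.all (Dfn.imp (Dfn₂.app dfn_rankLE (.var _) (.var _))
        (Dfn.iff (Dfn₁.app dT (.var _)) (Dfn₁.app dT' (.var _))))
    by_cases hsent : IsSentence s
    swap
    · exact iff_of_false (fun h => hsent (hT.isSentence h)) (fun h => hsent (hT'.isSentence h))
    obtain ⟨hneg, hconj, hall⟩ := hs.cases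
    rcases hsent.cases with ⟨p, q, h | h, hp, hq⟩ | ⟨p, h, hp⟩ | ⟨p, q, h, hp, hq⟩ | ⟨i, p, h⟩
    -- For atomic sentences, Tarski's clauses give a condition on values that does not mention the
    -- truth predicate.
    · rw [hT.eq_iff hp hq h, hT'.eq_iff hp hq h]
    · rw [hT.lt_iff hp hq h, hT'.lt_iff hp hq h]
    · obtain ⟨d', hd', hr⟩ := hneg p h
      rw [hT.neg_iff hp h, hT'.neg_iff hp h, ih d' hd' p hr]
    · obtain ⟨⟨d₁, hd₁, hr₁⟩, d₂, hd₂, hr₂⟩ := hconj p q h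
      rw [hT.conj_iff hp hq h, hT'.conj_iff hp hq h, ih d₁ hd₁ p hr₁, ih d₂ hd₂ q hr₂]
    · obtain ⟨d', hd', hr⟩ := hall i p h
      rw [hT.all_iff hsent h, hT'.all_iff hsent h]
      exact forall_congr' fun n => forall_congr' fun t => forall_congr' fun s' =>
        imp_congr_right fun hs' => ih d' hd' s' (hr.subst hs'.2)
  by_cases hsent : IsSentence s
  · exact key s s hsent.1.rankLE_self
  · exact iff_of_false (fun h => hsent (hT.isSentence h)) (fun h => hsent (hT'.isSentence h))

end Uniqueness

/-! ### Solidity -/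

/-- The structure `M` with the truth predicate replaced by `T`. -/
@[reducible]
def withTruth (M : Type w) [LangT.Structure M] (T : M → Prop) : LangT.Structure M where
  funMap F v := Structure.funMap (L := LangT) F v
  RelMap {_} R v := match R with
    | Rel.lt => Structure.RelMap (L := LangT) Rel.lt v
    | Rel.tr => T (v 0)

/-! ### Transfer of arithmetic and truth along the canonical map. -/

section Pullback

variable {M N : Type w} [LangT.Structure M] [LangT.Structure N] [M ⊨ PAT] [N ⊨ PAT] {j : M → N}

theorem map_funMap_of_hom (h0 : j 0 = 0) (hs : ∀ a, j (a + 1) = j a + 1)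
    (ha : ∀ a b, j (a + b) = j a + j b) (hm : ∀ a b, j (a * b) = j a * j b) {n : ℕ}
    (F : LangT.Functions n) (v : Fin n → M) :
    j (Structure.funMap F v) = Structure.funMap F (j ∘ v) := by
  cases F with
  | zero =>
    rw [Subsingleton.elim v ![], Subsingleton.elim (j ∘ ![]) ![] ]
    exact h0
  | succ =>
    rw [show v = ![v 0] by ext i; fin_cases i; rfl,
      show j ∘ ![v 0] = ![j (v 0)] by ext i; fin_cases i; rfl]
    have := hs (v 0)
    rwa [← succOf_eq, ← succOf_eq] at this
  | add =>
    rw [show v = ![v 0, v 1] by ext i; fin_cases i <;> rfl,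
      show j ∘ ![v 0, v 1] = ![j (v 0), j (v 1)] by ext i; fin_cases i <;> rfl]
    exact ha (v 0) (v 1)
  | mul =>
    rw [show v = ![v 0, v 1] by ext i; fin_cases i <;> rfl,
      show j ∘ ![v 0, v 1] = ![j (v 0), j (v 1)] by ext i; fin_cases i <;> rfl]
    exact hm (v 0) (v 1)

theorem relMap_lt_iff_of_strictMono (hj : StrictMono j) (v : Fin 2 → M) :
    Structure.RelMap (L := LangT) Rel.lt (j ∘ v) ↔ Structure.RelMap (L := LangT) Rel.lt v := by
  rw [show v = ![v 0, v 1] by ext i; fin_cases i <;> rfl,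
    show j ∘ ![v 0, v 1] = ![j (v 0), j (v 1)] by ext i; fin_cases i <;> rfl]
  exact hj.lt_iff_lt (a := v 0) (b := v 1)

/-- With `T` reinterpreted as the preimage of the truth predicate of `N`, the map `j` is an
isomorphism of structures for the full language, so the single sentence `tarski` passes from `N`
back to `M`. -/
theorem isTruth_pullback (hN : N ⊨ tarski) (hb : Function.Bijective j)
    (hf : ∀ {n : ℕ} (F : LangT.Functions n) (v : Fin n → M),
      j (Structure.funMap F v) = Structure.funMap F (j ∘ v)) (hj : StrictMono j) :
    IsTruth (fun a => trOf (j a)) := by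
  have hlt := relMap_lt_iff_of_strictMono hj
  have htr (v : Fin 1 → M) :
      Structure.RelMap (L := LangT) Rel.tr (j ∘ v) ↔ trOf (j (v 0)) := by
    rw [show j ∘ v = ![j (v 0)] by ext i; fin_cases i; rfl]
    rfl
  have hM : IsArith M := inferInstance
  have hA : @IsArith M (withTruth M fun a => trOf (j a)) _ _ :=
    @IsArith.mk M (withTruth M fun a => trOf (j a)) _ _
      hM.zeroOf_eq hM.succOf_eq hM.addOf_eq hM.mulOf_eq hM.ltOf_iff
  refine @isTruth_trOf M (withTruth M fun a => trOf (j a)) _ _ hA ?_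
  exact (@StrongHomClass.realize_sentence LangT M N (withTruth M fun a => trOf (j a)) _ _ _ _
    (@Language.Equiv.mk LangT M N (withTruth M fun a => trOf (j a)) _ (Equiv.ofBijective j hb)
      hf (fun R v => by
        cases R with
        | lt => exact hlt v
        | tr => exact htr v)) tarski).2 hN

end Pullback

theorem isSolid_CT : Solidity.IsSolid.{0, 0, w} CT := by
  intro M N M' _ _ _ hM hN hM' e e' he he' ⟨i₀, hi₀⟩
  have hMP : M ⊨ PAT := hM.mono Set.subset_union_left
  have hNP : N ⊨ PAT := hN.mono Set.subset_union_left
  have hMP' : M' ⊨ PAT := hM'.mono Set.subset_union_left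
  have hMT : M ⊨ tarski := hM.realize_of_mem _ (Or.inr rfl)
  have hNT : N ⊨ tarski := hN.realize_of_mem _ (Or.inr rfl)
  obtain ⟨j, hj, h0, hs⟩ := exists_canonical_map he
  have hb : Function.Bijective j :=
    canonical_bijective he he' (dfn_iff_definable.2 hi₀) hj h0 hs
  have hf {n : ℕ} (F : LangT.Functions n) (v : Fin n → M) :
      j (Structure.funMap F v) = Structure.funMap F (j ∘ v) :=
    map_funMap_of_hom h0 hs (canonical_add he hj h0 hs) (canonical_mul he hj h0 hs) F v
  have hmono : StrictMono j := canonical_strictMono he hj h0 hs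
  have hT : ∀ a, trOf (j a) ↔ trOf a := by
    refine (isTruth_pullback hNT hb hf hmono).unique (isTruth_trOf hMT) ?_ (Dfn.trOf (.var _))
    -- The pulled-back predicate is definable in `M` because the graph of `j` and the truth
    -- predicate of `N` are; without this, induction in `M` could not compare it with `T`.
    refine Dfn.congr (P := fun v => ∃ c, c = e (j (v 0)) ∧ ∃ n, c = e n ∧ trOf n) ?_ fun v => ?_
    · exact Dfn.ex (Dfn.and (Dfn₂.app hj (.var _) (.var _))
        (Dfn₁.app (dfn_rel₁ he Rel.tr) (.var _)))
    · simp [he.injective.eq_iff]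
  refine ⟨⟨Equiv.ofBijective j hb, hf, fun {n} R v => ?_⟩, dfn_iff_definable.1 hj⟩
  cases R with
  | lt => exact relMap_lt_iff_of_strictMono hmono v
  | tr =>
    change Structure.RelMap (L := LangT) Rel.tr (j ∘ v) ↔ _
    rw [show v = ![v 0] by ext i; fin_cases i; rfl,
      show j ∘ ![v 0] = ![j (v 0)] by ext i; fin_cases i; rfl]
    exact hT (v 0)

end Truth

theorem theorem5p7 : Solidity.IsSolid.{0, 0, w} Truth.CT :=
  Truth.isSolid_CT
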